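/- Let $S$ be an affine scheme, let $X \to S$ be a morphism of schemes such that $X$ is an AF-scheme, that is, every finite set of points of $X$ is contained in an affine open subset of $X$, and let $d \geq 0$ be an integer. Call a morphism of schemes $p \colon Z \to T$ finite and flat of rank $d$ if $p$ is finite and $p_*\mathcal{O}_Z$ is a locally free $\mathcal{O}_T$-module of constant rank $d$. Let $\mathcal{H}ilb^d_{X/S}$ be the Hilbert functor of $d$ points on $X/S$, i.e. the contravariant functor from $S$-schemes to sets that sends an $S$-scheme $T$ to the set of closed subschemes $Z \hookrightarrow X \times_S T$ such that the second projection $Z \to T$ is finite and flat of rank $d$, and that acts on morphisms of $S$-schemes by pull-back of closed subschemes. Then $\mathcal{H}ilb^d_{X/S}$ is represented by a scheme over $S$. -/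

import Mathlib

open CategoryTheory CategoryTheory.Limits AlgebraicGeometry

universe u

namespace HilbertPoints

/-- `B` is free of rank `d` as a module over `A`, via the ring homomorphism `φ : A →+* B`. -/
def RingHomFreeOfRank {A B : Type u} [CommRing A] [CommRing B] (φ : A →+* B) (d : ℕ) : Prop :=
  letI := φ.toAlgebra
  Nonempty (Module.Basis (Fin d) A B)

/-- A morphism `f : X ⟶ Y` of schemes is finite and flat of rank `d` if it is finite and
`f_* 𝒪_X` is a locally free `𝒪_Y`-module of constant rank `d`. As `f` is finite, `f_* 𝒪_X` is
quasi-coherent, so its restriction to an affine open `V` of `Y` is free of rank `d` precisely when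
its module of sections `Γ(X, f ⁻¹ V)` is free of rank `d` over `Γ(Y, V)`. -/
def IsFiniteFlatOfRank {X Y : Scheme.{u}} (f : X ⟶ Y) (d : ℕ) : Prop :=
  IsFinite f ∧ ∀ y : Y, ∃ V : Y.Opens, IsAffineOpen V ∧ y ∈ V ∧
    RingHomFreeOfRank (f.app V).hom d

/-- An AF-scheme: every finite set of points is contained in an affine open subset. -/
def IsAFScheme (X : Scheme.{u}) : Prop :=
  ∀ Z : Set X, Z.Finite → ∃ U : X.Opens, IsAffineOpen U ∧ Z ⊆ (U : Set X)

lemma RingHomFreeOfRank.of_isPushout {A B A' B' : CommRingCat.{u}} {φ : A ⟶ B} {ψ : A ⟶ A'}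
    {inl : B ⟶ B'} {inr : A' ⟶ B'} (h : IsPushout φ ψ inl inr) {d : ℕ}
    (hφ : RingHomFreeOfRank φ.hom d) : RingHomFreeOfRank inr.hom d := by
  let := φ.hom.toAlgebra
  let := ψ.hom.toAlgebra
  let := inl.hom.toAlgebra
  let := inr.hom.toAlgebra
  let := (φ ≫ inl).hom.toAlgebra
  have : IsScalarTower A B B' := IsScalarTower.of_algebraMap_eq fun _ ↦ rfl
  have : IsScalarTower A A' B' := IsScalarTower.of_algebraMap_eq fun x ↦
    congr($(h.w).hom x)
  have hp : Algebra.IsPushout A A' B B' :=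
    (CommRingCat.isPushout_iff_isPushout (R := A) (S := B) (R' := A') (S' := B')).mp h.flip
  obtain ⟨b⟩ := hφ
  exact ⟨hp.out.basis b⟩

lemma IsFiniteFlatOfRank.of_isPullback {X Y X' Y' : Scheme.{u}} {g' : X' ⟶ X} {f' : X' ⟶ Y'}
    {f : X ⟶ Y} {g : Y' ⟶ Y} (h : IsPullback g' f' f g) {d : ℕ}
    (hf : IsFiniteFlatOfRank f d) : IsFiniteFlatOfRank f' d := by
  obtain ⟨hfin, hfree⟩ := hf
  refine ⟨MorphismProperty.of_isPullback (P := @IsFinite) h hfin, fun y ↦ ?_⟩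
  obtain ⟨V, hV, hyV, hfr⟩ := hfree (g y)
  obtain ⟨W, hW, hyW, hWV⟩ := exists_isAffineOpen_mem_and_subset (X := Y') (x := y) (U := g ⁻¹ᵁ V) hyV
  have hUY : f' ⁻¹ᵁ W = g' ⁻¹ᵁ (f ⁻¹ᵁ V) ⊓ f' ⁻¹ᵁ W := by
    refine le_antisymm (le_inf ?_ le_rfl) inf_le_right
    rw [← Scheme.Hom.comp_preimage, h.w, Scheme.Hom.comp_preimage]
    exact f'.preimage_mono hWV
  have hp := (isIso_pushoutSection_iff h hWV le_rfl hUY).mp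
    (isIso_pushoutSection_of_isAffineOpen h hWV le_rfl hUY hV hW (hV.preimage f))
  refine ⟨W, hW, hyW, ?_⟩
  rw [← Scheme.Hom.app_eq_appLE] at hp
  have := RingHomFreeOfRank.of_isPushout hp hfr
  rwa [← Scheme.Hom.app_eq_appLE] at this

/-- The morphism `X ×_S T' ⟶ X ×_S T` induced by a morphism `h : T' ⟶ T` of `S`-schemes. -/
noncomputable def baseChangeMap {X S : Scheme.{u}} (f : X ⟶ S) {T' T : Over S} (h : T' ⟶ T) :
    pullback f T'.hom ⟶ pullback f T.hom :=
  pullback.lift (pullback.fst f T'.hom) (pullback.snd f T'.hom ≫ h.left)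
    (by rw [Category.assoc, Over.w h, pullback.condition])

@[simp]
lemma baseChangeMap_fst {X S : Scheme.{u}} (f : X ⟶ S) {T' T : Over S} (h : T' ⟶ T) :
    baseChangeMap f h ≫ pullback.fst f T.hom = pullback.fst f T'.hom :=
  pullback.lift_fst _ _ _

@[simp]
lemma baseChangeMap_snd {X S : Scheme.{u}} (f : X ⟶ S) {T' T : Over S} (h : T' ⟶ T) :
    baseChangeMap f h ≫ pullback.snd f T.hom = pullback.snd f T'.hom ≫ h.left :=
  pullback.lift_snd _ _ _

lemma baseChangeMap_id {X S : Scheme.{u}} (f : X ⟶ S) (T : Over S) :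
    baseChangeMap f (𝟙 T) = 𝟙 _ := by
  refine pullback.hom_ext ?_ ?_ <;> simp

lemma baseChangeMap_comp {X S : Scheme.{u}} (f : X ⟶ S) {T'' T' T : Over S}
    (h' : T'' ⟶ T') (h : T' ⟶ T) :
    baseChangeMap f (h' ≫ h) = baseChangeMap f h' ≫ baseChangeMap f h := by
  apply pullback.hom_ext
  · rw [Category.assoc, baseChangeMap_fst, baseChangeMap_fst, baseChangeMap_fst]
  · rw [Category.assoc, baseChangeMap_snd, baseChangeMap_snd, ← Category.assoc, baseChangeMap_snd,
      Category.assoc, Over.comp_left]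

lemma isPullback_baseChangeMap {X S : Scheme.{u}} (f : X ⟶ S) {T' T : Over S} (h : T' ⟶ T) :
    IsPullback (baseChangeMap f h) (pullback.snd f T'.hom) (pullback.snd f T.hom) h.left := by
  refine IsPullback.of_right (h₁₂ := pullback.fst f T.hom) (h₂₂ := T.hom) (v₁₃ := f) ?_
    (baseChangeMap_snd f h) (IsPullback.of_hasPullback f T.hom)
  rw [baseChangeMap_fst, Over.w h]
  exact IsPullback.of_hasPullback f T'.hom

lemma isFiniteFlatOfRank_comap {X S : Scheme.{u}} (f : X ⟶ S) {T' T : Over S} (h : T' ⟶ T) (d : ℕ)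
    (I : (pullback f T.hom).IdealSheafData)
    (hI : IsFiniteFlatOfRank (I.subschemeι ≫ pullback.snd f T.hom) d) :
    IsFiniteFlatOfRank
      ((I.comap (baseChangeMap f h)).subschemeι ≫ pullback.snd f T'.hom) d := by
  have h₁ : IsPullback ((I.comapIso (baseChangeMap f h)).hom ≫ pullback.snd _ _)
      (I.comap (baseChangeMap f h)).subschemeι I.subschemeι (baseChangeMap f h) :=
    (IsPullback.of_hasPullback (baseChangeMap f h) I.subschemeι).flip.of_iso
      (I.comapIso (baseChangeMap f h)).symm (Iso.refl _) (Iso.refl _) (Iso.refl _)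
      (by rw [Iso.symm_hom, Iso.inv_hom_id_assoc]; simp) (by simp) (by simp) (by simp)
  exact hI.of_isPullback (h₁.paste_vert (isPullback_baseChangeMap f h))

/-- The Hilbert functor of `d` points on `X/S`: it sends an `S`-scheme `T` to the set of closed
subschemes `Z` of `X ×_S T`, given by their quasi-coherent ideal sheaves, such that the projection
`Z ⟶ T` is finite and flat of rank `d`. A morphism `T' ⟶ T` of `S`-schemes acts by pulling back
closed subschemes along `X ×_S T' ⟶ X ×_S T`. -/
noncomputable def hilbertFunctor {X S : Scheme.{u}} (f : X ⟶ S) (d : ℕ) :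
    (Over S)ᵒᵖ ⥤ Type u where
  obj T := {I : (pullback f T.unop.hom).IdealSheafData //
    IsFiniteFlatOfRank (I.subschemeι ≫ pullback.snd f T.unop.hom) d}
  map h := ↾fun I ↦ ⟨I.1.comap (baseChangeMap f h.unop),
    isFiniteFlatOfRank_comap f h.unop d I.1 I.2⟩
  map_id T := by
    ext I : 3
    refine Subtype.ext ?_
    change I.1.comap (baseChangeMap f (𝟙 T.unop)) = I.1
    rw [baseChangeMap_id, Scheme.IdealSheafData.comap_id]
  map_comp h h' := by
    ext I : 3
    refine Subtype.ext ?_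
    change I.1.comap (baseChangeMap f (h'.unop ≫ h.unop)) =
      (I.1.comap (baseChangeMap f h.unop)).comap (baseChangeMap f h'.unop)
    rw [baseChangeMap_comp, Scheme.IdealSheafData.comap_comp]

end HilbertPoints

/-! The scheme is built by gluing affine charts, one for each affine open `U` of `X` and each family
`b` of `d` functions on `U`. The chart of `(U, b)` parametrizes those `Z` in `X ×_S T` that map into
`U` and on which the pullbacks of `b` form a basis of the functions over `𝒪_T`.

Such a `Z` is the same thing as its table of coefficients. Each function `x` on `U` restricts to a
combination of the `b i` with coefficients `c x i` in `𝒪_T`. These satisfy additivity, linearity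
over `Γ(S, ⊤)`, a normalization on `b`, and an identity expressing multiplication
(`IsCoefficients`). Conversely, a table with these properties defines an algebra with basis `b`
(`IsCoefficients.exists_algebra`), and two closed subschemes with the same table coincide
(`ker_eq_of_hasCoefficients`). The conditions are polynomial, so tables are represented by an affine
scheme, with a universal family over it (`exists_universalFamily`).

The chart is an open subfunctor: mapping into `U` is an open condition on `T` because finite
morphisms are closed, and being a basis is the invertibility of a determinant
(`mem_locus_iff_of_isPullback`).

The charts cover: a fibre of `Z ⟶ T` is a finite set, so the AF hypothesis places its image in one
affine `U`. As `Z` is closed in `X ×_S T`, functions on `U` span the functions on `Z` near this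
fibre, and `d` of them form a basis there (`exists_mem_locus`). The AF hypothesis also makes `X`
separated over `S`, so that the universal family is closed in the whole of `X ×_S H` and not only in
the part over `U`.

Finally, ideal sheaves glue, so the Hilbert functor is a Zariski sheaf
(`hasUniqueGluing_hilbertFunctor`). A Zariski sheaf covered by representable open subfunctors is
representable (`isRepresentable_of_isOpenChart`). -/

namespace HilbertPoints

/-! ### Bases, determinants and coefficient tables -/

section Algebra

/-- The family `v` is a basis of `B` as an `A`-module via `φ : A →+* B`. -/
def IsBasisVia {A B : Type*} [CommRing A] [CommRing B] (φ : A →+* B) {d : ℕ} (v : Fin d → B) :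
    Prop :=
  Function.Bijective fun c : Fin d → A ↦ ∑ i, φ (c i) * v i

variable {A B : Type*} [CommRing A] [CommRing B] {d : ℕ}

lemma IsBasisVia.exists_basis [Algebra A B] {v : Fin d → B}
    (h : IsBasisVia (algebraMap A B) v) : ∃ e : Module.Basis (Fin d) A B, ⇑e = v := by
  let l : (Fin d → A) →ₗ[A] B := Fintype.linearCombination A v
  have hl : Function.Bijective l := by
    have : ⇑l = fun c ↦ ∑ i, algebraMap A B (c i) * v i := by
      ext c
      simp [l, Fintype.linearCombination_apply, Algebra.smul_def]
    rw [this]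
    exact h
  refine ⟨.ofEquivFun (LinearEquiv.ofBijective l hl).symm, ?_⟩
  ext i
  rw [Module.Basis.coe_ofEquivFun]
  simp [l, Fintype.linearCombination_apply, Pi.single_apply]

lemma IsBasisVia.of_basis [Algebra A B] (e : Module.Basis (Fin d) A B) :
    IsBasisVia (algebraMap A B) e := by
  have : ⇑e.equivFun.symm = fun c ↦ ∑ i, algebraMap A B (c i) * e i := by
    ext c
    simp [Module.Basis.equivFun_symm_apply, Algebra.smul_def]
  rw [IsBasisVia, ← this]
  exact e.equivFun.symm.bijective

lemma RingHomFreeOfRank.exists_isBasisVia {A B : Type u} [CommRing A] [CommRing B] {φ : A →+* B}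
    (h : RingHomFreeOfRank φ d) : ∃ v : Fin d → B, IsBasisVia φ v := by
  let := φ.toAlgebra
  obtain ⟨e⟩ := h
  exact ⟨e, .of_basis e⟩

lemma IsBasisVia.freeOfRank {A B : Type u} [CommRing A] [CommRing B] {φ : A →+* B}
    {v : Fin d → B} (h : IsBasisVia φ v) : RingHomFreeOfRank φ d := by
  let := φ.toAlgebra
  obtain ⟨e, -⟩ := IsBasisVia.exists_basis (A := A) (B := B) h
  exact ⟨e⟩

lemma IsBasisVia.of_isPushout {A B A' B' : CommRingCat.{u}} {φ : A ⟶ B} {ψ : A ⟶ A'}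
    {inl : B ⟶ B'} {inr : A' ⟶ B'} (h : IsPushout φ ψ inl inr) {v : Fin d → B}
    (hv : IsBasisVia φ.hom v) : IsBasisVia inr.hom (fun i ↦ inl.hom (v i)) := by
  let := φ.hom.toAlgebra
  let := ψ.hom.toAlgebra
  let := inl.hom.toAlgebra
  let := inr.hom.toAlgebra
  let := (φ ≫ inl).hom.toAlgebra
  have : IsScalarTower A B B' := IsScalarTower.of_algebraMap_eq fun _ ↦ rfl
  have : IsScalarTower A A' B' := IsScalarTower.of_algebraMap_eq fun x ↦
    congr($(h.w).hom x)
  have hp : Algebra.IsPushout A A' B B' :=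
    (CommRingCat.isPushout_iff_isPushout (R := A) (S := B) (R' := A') (S' := B')).mp h.flip
  obtain ⟨e, rfl⟩ := IsBasisVia.exists_basis (A := A) (B := B) hv
  have := IsBasisVia.of_basis (hp.out.basis e)
  convert! this using 2 with i
  rw [IsBaseChange.basis_apply]
  rfl

/-- The combination map of `v` is that of `e`, which is bijective, composed with multiplication by
`M`. -/
lemma IsBasisVia.iff_isUnit_det {φ : A →+* B} {e : Fin d → B} (he : IsBasisVia φ e)
    {v : Fin d → B} {M : Matrix (Fin d) (Fin d) A}
    (hM : ∀ j, v j = ∑ i, φ (M i j) * e i) : IsBasisVia φ v ↔ IsUnit M.det := by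
  have : (fun c : Fin d → A ↦ ∑ i, φ (c i) * v i) =
      (fun c : Fin d → A ↦ ∑ i, φ (c i) * e i) ∘ M.mulVec := by
    ext c
    simp only [hM, Function.comp, Matrix.mulVec, dotProduct, map_sum, map_mul, Finset.mul_sum,
      Finset.sum_mul]
    rw [Finset.sum_comm]
    exact Finset.sum_congr rfl fun _ _ ↦ Finset.sum_congr rfl fun _ _ ↦ by ring
  rw [IsBasisVia, this, Function.Bijective.of_comp_iff' he, ← Matrix.isUnit_iff_isUnit_det]
  exact ⟨fun h ↦ Matrix.mulVec_surjective_iff_isUnit.mp h.2, fun h ↦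
    ⟨Matrix.mulVec_injective_of_isUnit h, Matrix.mulVec_surjective_iff_isUnit.mpr h⟩⟩

lemma IsBasisVia.exists_matrix {φ : A →+* B} {e : Fin d → B} (he : IsBasisVia φ e)
    (v : Fin d → B) : ∃ M : Matrix (Fin d) (Fin d) A, ∀ j, v j = ∑ i, φ (M i j) * e i := by
  choose c hc using fun j ↦ he.2 (v j)
  exact ⟨fun i j ↦ c j i, fun j ↦ (hc j).symm⟩

/-- A subset spanning a free module of finite rank contains a family which is a basis at a given
prime. -/
lemma IsBasisVia.exists_det_notMem {B₀ : Type*} {φ : A →+* B} {e : Fin d → B}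
    (he : IsBasisVia φ e) (χ : B₀ → B)
    (hχ : ∀ I : AddSubgroup B, (∀ a b, φ a * χ b ∈ I) → I = ⊤)
    (P : Ideal A) [P.IsPrime] :
    ∃ (w : Fin d → B₀) (M : Matrix (Fin d) (Fin d) A),
      (∀ j, χ (w j) = ∑ i, φ (M i j) * e i) ∧ M.det ∉ P := by
  choose c hc using he.2
  replace hc : ∀ x, ∑ i, φ (c x i) * e i = x := hc
  have hcφ (a : Fin d → A) : c (∑ i, φ (a i) * e i) = a := he.1 (hc _)
  have hc_add (x y) : c (x + y) = c x + c y := by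
    rw [← hcφ (c x + c y)]
    simp only [Pi.add_apply, map_add, add_mul, Finset.sum_add_distrib]
    rw [hc, hc]
  have hc_mul (a x) : c (φ a * x) = a • c x := by
    rw [← hcφ (a • c x)]
    simp only [Pi.smul_apply, smul_eq_mul, map_mul, mul_assoc, ← Finset.mul_sum]
    rw [hc]
  let k := P.ResidueField
  let g : A →+* k := algebraMap A k
  let s : Set (Fin d → k) := Set.range fun b i ↦ g (c (χ b) i)
  -- The elements whose coordinates modulo `P` lie in the span of `s` form a subgroup containing all
  -- `φ a * χ b`, so `hχ` applies.
  have hs : Submodule.span k s = ⊤ := by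
    let I : AddSubgroup B :=
      { carrier := {x | (fun i ↦ g (c x i)) ∈ Submodule.span k s}
        add_mem' := fun {x y} hx hy ↦ by
          have : (fun i ↦ g (c (x + y) i)) = (fun i ↦ g (c x i)) + fun i ↦ g (c y i) := by
            ext i; simp [hc_add]
          simpa [this] using add_mem hx hy
        zero_mem' := by
          have : c 0 = 0 := by simpa using hc_mul 0 0
          have : (fun i ↦ g (c 0 i)) = 0 := by ext i; simp [this]
          simp [this]
        neg_mem' := fun {x} hx ↦ by
          have h : c (-x) = - c x := by simpa using hc_mul (-1) x
          have : (fun i ↦ g (c (-x) i)) = - fun i ↦ g (c x i) := by ext i; simp [h]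
          simpa [this] using neg_mem hx }
    have hI : I = ⊤ := hχ I fun a b ↦ by
      have : (fun i ↦ g (c (φ a * χ b) i)) = g a • fun i ↦ g (c (χ b) i) := by
        ext i; simp [hc_mul]
      change _ ∈ Submodule.span k s
      rw [this]
      exact Submodule.smul_mem _ _ (Submodule.subset_span ⟨b, rfl⟩)
    rw [eq_top_iff, ← (Pi.basisFun k (Fin d)).span_eq, Submodule.span_le]
    rintro _ ⟨j, rfl⟩
    have h : (∑ i, φ ((Pi.single j 1 : Fin d → A) i) * e i) ∈ I := hI ▸ trivial
    change (fun i ↦ g _) ∈ Submodule.span k s at h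
    rw [hcφ] at h
    have hj : (fun i ↦ g ((Pi.single j 1 : Fin d → A) i)) = Pi.basisFun k (Fin d) j := by
      ext i
      simp only [Pi.single_apply, Pi.basisFun_apply]
      split_ifs <;> simp
    rwa [hj] at h
  -- A basis of `k ^ d` extracted from a spanning set has `d` elements; lifting them to `B₀` gives
  -- `w`.
  obtain ⟨t, hts, ht, hli⟩ := exists_linearIndependent k s
  rw [hs] at ht
  let E : Module.Basis t k (Fin d → k) := .mk hli (by simp [ht])
  have : Finite t := Module.Finite.finite_basis E
  let _ : Fintype t := Fintype.ofFinite t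
  have hcard : Fintype.card t = d := by
    rw [← Module.finrank_eq_card_basis E, Module.finrank_fin_fun]
  let σ : t ≃ Fin d := Fintype.equivFinOfCardEq hcard
  choose w hw using fun j ↦ hts (σ.symm j).2
  refine ⟨w, Matrix.of fun i j ↦ c (χ (w j)) i, fun j ↦ (hc _).symm, fun hP ↦ ?_⟩
  have h0 : g (Matrix.of fun i j ↦ c (χ (w j)) i).det = 0 := by
    rwa [Ideal.algebraMap_residueField_eq_zero]
  -- Modulo `P` the matrix is a change of basis between the standard basis and `E`, so its
  -- determinant cannot vanish.
  have hE := (Pi.basisFun k (Fin d)).isUnit_det (E.reindex σ)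
  rw [Module.Basis.det_apply] at hE
  refine hE.ne_zero ?_
  rw [← h0, RingHom.map_det]
  congr 1
  ext i j
  simp [Module.Basis.toMatrix_apply, E, ← hw]

/-- The data `c` are the coefficients, with respect to the images of `b`, of an `A`-algebra map
from `B` to an `R`-algebra of which the images of `b` are a basis. -/
structure IsCoefficients {R : Type*} [CommRing R] (α : A →+* B) (ρ : A →+* R) (b : Fin d → B)
    (c : B → Fin d → R) : Prop where
  add (x y : B) (i : Fin d) : c (x + y) i = c x i + c y i
  smul (a : A) (x : B) (i : Fin d) : c (α a * x) i = ρ a * c x i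
  basis (i j : Fin d) : c (b j) i = if i = j then 1 else 0
  -- Expand `y` in the basis and multiply by `x`. In this form the relation says that the submodule
  -- generated by the elements `x - ∑ i, c x i * b i`, multiplied by any `B`-element, is still
  -- killed by the coefficient map.
  mul (x y : B) (j : Fin d) : c (x * y) j = ∑ i, c y i * c (x * b i) j

/-- Each relation compares the coefficients of one element of `Q`, and these are unique. -/
lemma IsBasisVia.isCoefficients {R Q : Type*} [CommRing R] [CommRing Q] {α : A →+* B}
    {ρ : A →+* R} {κ : R →+* Q} {χ : B →+* Q} (hw : χ.comp α = κ.comp ρ) {b : Fin d → B}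
    (hb : IsBasisVia κ (χ ∘ b)) {c : B → Fin d → R}
    (hc : ∀ x, χ x = ∑ i, κ (c x i) * χ (b i)) : IsCoefficients α ρ b c := by
  have key {p q : Fin d → R} (h : ∑ i, κ (p i) * χ (b i) = ∑ i, κ (q i) * χ (b i)) : p = q :=
    hb.1 h
  refine ⟨fun x y i ↦ ?_, fun a x i ↦ ?_, fun i j ↦ ?_, fun x y j ↦ ?_⟩
  · refine congr_fun (key (q := c x + c y) ?_) i
    simp [← hc, add_mul, Finset.sum_add_distrib]
  · refine congr_fun (key (q := ρ a • c x) ?_) i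
    simp only [← hc, Pi.smul_apply, smul_eq_mul, map_mul, mul_assoc, ← Finset.mul_sum]
    exact congr($hw a * _)
  · refine congr_fun (key (q := fun i ↦ if i = j then 1 else 0) ?_) i
    simp [← hc, apply_ite κ]
  · refine congr_fun (key (q := fun j ↦ ∑ i, c y i * c (x * b i) j) ?_) j
    rw [← hc]
    simp only [map_sum, map_mul, Finset.sum_mul]
    rw [Finset.sum_comm]
    simp only [mul_assoc, ← Finset.mul_sum, ← hc]
    rw [hc y, Finset.mul_sum]
    exact Finset.sum_congr rfl fun i _ ↦ by rw [map_mul]; ring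

section Universal

variable (A B : Type u) [CommRing A] [CommRing B] [Algebra A B] (b : Fin d → B)

/-- The relations between the universal coefficients. -/
inductive CoefficientRel : MvPolynomial (B × Fin d) A → Prop
  | add (x y : B) (i : Fin d) : CoefficientRel (.X (x + y, i) - (.X (x, i) + .X (y, i)))
  | smul (a : A) (x : B) (i : Fin d) :
      CoefficientRel (.X (algebraMap A B a * x, i) - .C a * .X (x, i))
  | basis (i j : Fin d) : CoefficientRel (.X (b j, i) - if i = j then 1 else 0)
  | mul (x y : B) (j : Fin d) :
      CoefficientRel (.X (x * y, j) - ∑ i, .X (y, i) * .X (x * b i, j))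

/-- The ring carrying the universal coefficients. -/
abbrev CoefficientRing : Type u :=
  MvPolynomial (B × Fin d) A ⧸ Ideal.span {p | CoefficientRel A B b p}

/-- The universal coefficients. -/
noncomputable def universalCoefficient (x : B) (i : Fin d) : CoefficientRing A B b :=
  Ideal.Quotient.mk _ (.X (x, i))

lemma isCoefficients_universalCoefficient :
    IsCoefficients (algebraMap A B) (algebraMap A (CoefficientRing A B b)) b
      (universalCoefficient A B b) where
  add x y i := by
    have := Ideal.Quotient.eq_zero_iff_mem.mpr
      (Ideal.subset_span (CoefficientRel.add (A := A) (b := b) x y i))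
    rwa [map_sub, sub_eq_zero, map_add] at this
  smul a x i := by
    have := Ideal.Quotient.eq_zero_iff_mem.mpr
      (Ideal.subset_span (CoefficientRel.smul (b := b) a x i))
    rwa [map_sub, sub_eq_zero, map_mul] at this
  basis i j := by
    have := Ideal.Quotient.eq_zero_iff_mem.mpr
      (Ideal.subset_span (CoefficientRel.basis (A := A) (b := b) i j))
    rw [map_sub, sub_eq_zero] at this
    refine this.trans ?_
    split_ifs <;> simp
  mul x y j := by
    have := Ideal.Quotient.eq_zero_iff_mem.mpr
      (Ideal.subset_span (CoefficientRel.mul (A := A) (b := b) x y j))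
    rwa [map_sub, sub_eq_zero, map_sum] at this

variable {A B b} in
lemma IsCoefficients.exists_lift {R : Type*} [CommRing R] {ρ : A →+* R} {c : B → Fin d → R}
    (hc : IsCoefficients (algebraMap A B) ρ b c) :
    ∃ g : CoefficientRing A B b →+* R, g.comp (algebraMap A _) = ρ ∧
      ∀ x i, g (universalCoefficient A B b x i) = c x i := by
  let g₀ : MvPolynomial (B × Fin d) A →+* R := MvPolynomial.eval₂Hom ρ fun p ↦ c p.1 p.2
  have hg₀ : ∀ p ∈ Ideal.span {p | CoefficientRel A B b p}, g₀ p = 0 := by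
    intro p hp
    rw [← RingHom.mem_ker]
    refine (Ideal.span_le (I := RingHom.ker g₀)).mpr ?_ hp
    rintro p ⟨⟩
    · simp [g₀, hc.add]
    · simp [g₀, hc.smul]
    · rw [SetLike.mem_coe, RingHom.mem_ker, map_sub, apply_ite g₀, map_one, map_zero]
      simp [g₀, hc.basis]
    · rw [SetLike.mem_coe, RingHom.mem_ker, map_sub, map_sum]
      simp only [map_mul, g₀, MvPolynomial.coe_eval₂Hom, MvPolynomial.eval₂_X]
      rw [hc.mul, sub_self]
  refine ⟨Ideal.Quotient.lift _ g₀ hg₀, ?_, fun x i ↦ ?_⟩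
  · ext a
    change Ideal.Quotient.lift _ g₀ hg₀ (Ideal.Quotient.mk _ (.C a)) = _
    simp [g₀]
  · simp [universalCoefficient, g₀]

variable {A B b} in
lemma CoefficientRing.hom_ext {R : Type*} [CommRing R] {g h : CoefficientRing A B b →+* R}
    (h₁ : g.comp (algebraMap A _) = h.comp (algebraMap A _))
    (h₂ : ∀ x i, g (universalCoefficient A B b x i) = h (universalCoefficient A B b x i)) :
    g = h := by
  refine Ideal.Quotient.ringHom_ext (MvPolynomial.ringHom_ext (fun a ↦ congr($h₁ a)) ?_)
  rintro ⟨x, i⟩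
  exact h₂ x i

end Universal

open TensorProduct in
/-- Any system of coefficients comes from an algebra. -/
lemma IsCoefficients.exists_algebra {A B C : Type u} [CommRing A] [CommRing B] [CommRing C]
    [Algebra A B] [Algebra A C] {b : Fin d → B} {c : B → Fin d → C}
    (hc : IsCoefficients (algebraMap A B) (algebraMap A C) b c) :
    ∃ (Q : Type u) (_ : CommRing Q) (κ : C →+* Q) (χ : B →+* Q),
      χ.comp (algebraMap A B) = κ.comp (algebraMap A C) ∧ IsBasisVia κ (χ ∘ b) ∧
      ∀ x, χ x = ∑ i, κ (c x i) * χ (b i) := by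
  -- The algebra is the quotient of `C ⊗[A] B` that forces every `x` to equal its prescribed
  -- expansion. Spanning is then automatic; independence is what needs the relations.
  let r (x : B) : C ⊗[A] B := (1 : C) ⊗ₜ[A] x - ∑ i, c x i ⊗ₜ[A] b i
  let K : Ideal (C ⊗[A] B) := Ideal.span (Set.range r)
  let κ : C →+* (C ⊗[A] B) ⧸ K :=
    (Ideal.Quotient.mk K).comp Algebra.TensorProduct.includeLeftRingHom
  let χ : B →+* (C ⊗[A] B) ⧸ K :=
    (Ideal.Quotient.mk K).comp (Algebra.TensorProduct.includeRight (R := A)).toRingHom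
  have hmk (y : C) (x : B) : Ideal.Quotient.mk K (y ⊗ₜ x) = κ y * χ x := by
    simp only [κ, χ, RingHom.comp_apply, ← map_mul]
    congr 1
    simp
  have hχ (x : B) : χ x = ∑ i, κ (c x i) * χ (b i) := by
    have := Ideal.Quotient.eq_zero_iff_mem.mpr (Ideal.subset_span (Set.mem_range_self (f := r) x))
    rw [map_sub, sub_eq_zero, map_sum] at this
    simp only [← hmk]
    exact this
  let l₀ : B →ₗ[A] (Fin d → C) :=
    { toFun := c
      map_add' := fun y z ↦ funext (hc.add y z)
      map_smul' := fun a y ↦ funext fun i ↦ by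
        rw [Algebra.smul_def, hc.smul, RingHom.id_apply, Pi.smul_apply, Algebra.smul_def] }
  let l : C ⊗[A] B →ₗ[C] (Fin d → C) := l₀.liftBaseChange C
  have hl (y : C) (x : B) : l (y ⊗ₜ x) = y • c x := LinearMap.liftBaseChange_tmul _ _ _ _
  have hlr (z : C ⊗[A] B) (x : B) : l (z * r x) = 0 := by
    induction z with
    | zero => simp
    | add z w hz hw => rw [add_mul, map_add, hz, hw, add_zero]
    | tmul y z =>
      ext j
      simp [r, mul_sub, Finset.mul_sum, Algebra.TensorProduct.tmul_mul_tmul, hl, hc.mul z x,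
        mul_assoc]
  -- The coefficient map `l` kills the ideal `K`, by the multiplicative relation. It therefore reads
  -- off coordinates in the quotient, which makes the `b i` independent.
  have hlK (z : C ⊗[A] B) (hz : z ∈ K) : ∀ w, l (w * z) = 0 := by
    induction hz using Submodule.span_induction with
    | mem z hz => obtain ⟨x, rfl⟩ := hz; exact fun w ↦ hlr w x
    | zero => simp
    | add z w _ _ hz hw => intro y; rw [mul_add, map_add, hz, hw, add_zero]
    | smul y z _ hz => intro w; rw [smul_eq_mul, ← mul_assoc]; exact hz _
  refine ⟨_, inferInstance, κ, χ, ?_, ⟨fun p q h ↦ ?_, fun z ↦ ?_⟩, hχ⟩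
  · ext a
    simp only [κ, χ, RingHom.comp_apply]
    congr 1
    change (1 : C) ⊗ₜ[A] algebraMap A B a = algebraMap A C a ⊗ₜ[A] (1 : B)
    rw [Algebra.algebraMap_eq_smul_one, Algebra.algebraMap_eq_smul_one, TensorProduct.smul_tmul]
  · simp only [Function.comp, ← hmk, ← map_sum] at h
    have := hlK _ (Ideal.Quotient.eq.mp h) 1
    rw [one_mul, map_sub, sub_eq_zero, map_sum, map_sum] at this
    ext i
    simpa [hl, hc.basis] using congr_fun this i
  · obtain ⟨z, rfl⟩ := Ideal.Quotient.mk_surjective z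
    induction z with
    | zero => exact ⟨0, by simp⟩
    | add z w hz hw =>
      obtain ⟨p, hp⟩ := hz
      obtain ⟨q, hq⟩ := hw
      exact ⟨p + q, by simp [add_mul, Finset.sum_add_distrib, ← hp, ← hq]⟩
    | tmul y x =>
      refine ⟨y • c x, ?_⟩
      simp only [hmk, hχ x, Pi.smul_apply, smul_eq_mul, map_mul, mul_assoc, Finset.mul_sum,
        Function.comp]

end Algebra

/-! ### Gluing of quasi-coherent ideal sheaves -/

section IdealSheaf

variable {X : Scheme.{u}}

/-- The restriction map between rings of sections. -/
def res {U V : X.Opens} (h : V ≤ U) : Γ(X, U) →+* Γ(X, V) := (X.presheaf.map (homOfLE h).op).hom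

lemma res_res {U V W : X.Opens} (h : V ≤ U) (h' : W ≤ V) (s : Γ(X, U)) :
    res h' (res h s) = res (h'.trans h) s := by
  simp only [res]
  rw [← CommRingCat.comp_apply, ← X.presheaf.map_comp]
  rfl

lemma res_self {U : X.Opens} (h : U ≤ U) (s : Γ(X, U)) : res h s = s := by
  simp only [res]
  rw [show (homOfLE h) = 𝟙 U from rfl, op_id, X.presheaf.map_id]
  rfl

lemma germ_res {U V : X.Opens} (h : V ≤ U) (x : X) (hx : x ∈ V) (s : Γ(X, U)) :
    (X.presheaf.germ V x hx).hom (res h s) = (X.presheaf.germ U x (h hx)).hom s :=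
  X.presheaf.germ_res_apply (homOfLE h) x hx s

lemma basicOpen_res' {U V : X.Opens} (h : V ≤ U) (s : Γ(X, U)) :
    X.basicOpen (res h s) = V ⊓ X.basicOpen s :=
  X.basicOpen_res s (homOfLE h).op

/-- A quasi-coherent ideal sheaf may be prescribed on a basis of affine open subsets which is
closed under passing to smaller affine open subsets. -/
lemma exists_idealSheafData (𝓑 : Set X.affineOpens) (hcov : ∀ x : X, ∃ V ∈ 𝓑, x ∈ V.1)
    (hdown : ∀ V W, V ≤ W → W ∈ 𝓑 → V ∈ 𝓑) (K : ∀ V : X.affineOpens, Ideal Γ(X, V))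
    (hK : ∀ (V W : X.affineOpens) (h : V.1 ≤ W.1), W ∈ 𝓑 → (K W).map (res h) = K V) :
    ∃ I : X.IdealSheafData, ∀ V ∈ 𝓑, I.ideal V = K V := by
  have small (x : X) (U : X.Opens) (hx : x ∈ U) :
      ∃ V ∈ 𝓑, x ∈ V.1 ∧ V.1 ≤ U := by
    obtain ⟨V, hV, hxV⟩ := hcov x
    obtain ⟨W, hW, hxW, hWV⟩ := exists_isAffineOpen_mem_and_subset (x := x) (U := U ⊓ V.1) ⟨hx, hxV⟩
    exact ⟨⟨W, hW⟩, hdown _ V (hWV.trans inf_le_right) hV, hxW, hWV.trans inf_le_left⟩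
  -- A section belongs to the ideal as soon as all its restrictions to members of `𝓑` do.
  let J (U : X.affineOpens) : Ideal Γ(X, U) :=
    ⨅ V : X.affineOpens, ⨅ h : V ∈ 𝓑 ∧ V.1 ≤ U.1, (K V).comap (res h.2)
  have mem_J (U : X.affineOpens) (s : Γ(X, U)) : s ∈ J U ↔
      ∀ (V : X.affineOpens) (_ : V ∈ 𝓑) (h : V.1 ≤ U.1), res h s ∈ K V := by
    simp [J]
  have J_eq (V : X.affineOpens) (hV : V ∈ 𝓑) : J V = K V := by
    ext s
    rw [mem_J]
    refine ⟨fun h ↦ ?_, fun hs W _ hWV ↦ ?_⟩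
    · simpa [res_self] using h V hV le_rfl
    · rw [← hK _ _ hWV hV]
      exact Ideal.mem_map_of_mem _ hs
  -- Membership in an ideal on an affine open can be tested on stalks, hence locally.
  have mem_K_of_forall (V : X.affineOpens) (hV : V ∈ 𝓑) (s : Γ(X, V))
      (h : ∀ x ∈ V.1, ∃ (W : X.affineOpens) (h : W.1 ≤ V.1), x ∈ W.1 ∧ res h s ∈ K W) :
      s ∈ K V := by
    rw [V.2.mem_ideal_iff]
    intro x hx
    obtain ⟨W, hWV, hxW, hW⟩ := h x hx
    rw [← hK _ _ hWV hV] at hW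
    have := Ideal.mem_map_of_mem (X.presheaf.germ W x hxW).hom hW
    rw [Ideal.map_map, germ_res] at this
    convert this using 2
    ext t
    exact (germ_res hWV x hxW t).symm
  have key (U : X.affineOpens) (f : Γ(X, U)) :
      (J U).map (res (X.basicOpen_le f)) = J (X.affineBasicOpen f) := by
    refine le_antisymm (Ideal.map_le_iff_le_comap.mpr fun s hs ↦ ?_) fun s hs ↦ ?_
    · refine (mem_J (X.affineBasicOpen f) _).mpr fun V hV hVU ↦ ?_
      have hVU' : V.1 ≤ X.basicOpen f := hVU
      have := (mem_J _ _).mp hs V hV (hVU'.trans (X.basicOpen_le f))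
      rwa [← res_res (X.basicOpen_le f) hVU'] at this
    · have := U.2.isLocalization_basicOpen f
      obtain ⟨a, ⟨_, n, rfl⟩, rfl⟩ := IsLocalization.exists_mk'_eq (.powers f) s
      refine (IsLocalization.mk'_mem_map_algebraMap_iff _ _ _ _ _).mpr ?_
      have ha : res (X.basicOpen_le f) a ∈ J (X.affineBasicOpen f) := by
        have := Ideal.mul_mem_left _ (algebraMap Γ(X, U) Γ(X, X.basicOpen f) (f ^ n)) hs
        convert! this using 1
        exact (IsLocalization.mk'_spec' Γ(X, X.basicOpen f) a
          (⟨f ^ n, n, rfl⟩ : Submonoid.powers f)).symm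
      have hfin : ∃ t : Finset X.affineOpens, (∀ V ∈ t, V ∈ 𝓑 ∧ V.1 ≤ U.1) ∧
          ∀ x ∈ U.1, ∃ V ∈ t, x ∈ V.1 := by
        choose V hV hxV hVU using fun x : U.1 ↦ small x.1 U.1 x.2
        obtain ⟨t, ht⟩ := U.2.isCompact.elim_finite_subcover (fun x ↦ ((V x).1 : Set X))
          (fun x ↦ (V x).1.2) (fun x hx ↦ Set.mem_iUnion.mpr ⟨⟨x, hx⟩, hxV _⟩)
        classical
        refine ⟨t.image V, ?_, fun x hx ↦ ?_⟩
        · simp only [Finset.mem_image]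
          rintro _ ⟨x, -, rfl⟩
          exact ⟨hV x, hVU x⟩
        · obtain ⟨y, hy, hxy⟩ := Set.mem_iUnion₂.mp (ht hx)
          exact ⟨V y, Finset.mem_image_of_mem _ hy, hxy⟩
      obtain ⟨t, ht, htU⟩ := hfin
      -- On a single `V` in `𝓑` a power of `f` clears denominators. All larger exponents are allowed
      -- as well, so that finitely many bounds can be combined.
      have hpow (V : X.affineOpens) (hV : V ∈ 𝓑) (hVU : V.1 ≤ U.1) : ∃ N : ℕ, ∀ n ≥ N,
          res hVU (f ^ n * a) ∈ K V := by
        let g : Γ(X, V) := res hVU f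
        have hgf : X.basicOpen g ≤ X.basicOpen f :=
          (basicOpen_res' hVU f).le.trans inf_le_right
        have h₁ : res hgf (res (X.basicOpen_le f) a) ∈ K (X.affineBasicOpen g) :=
          (mem_J _ _).mp ha (X.affineBasicOpen g) (hdown _ V (X.affineBasicOpen_le g) hV) hgf
        rw [← hK _ V (X.basicOpen_le g) hV, res_res, ← res_res hVU (X.basicOpen_le g)] at h₁
        have := V.2.isLocalization_basicOpen g
        obtain ⟨_, ⟨N, rfl⟩, hN⟩ :=
          (IsLocalization.algebraMap_mem_map_algebraMap_iff (.powers g) _ _ _).mp h₁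
        refine ⟨N, fun n hn ↦ ?_⟩
        obtain ⟨m, rfl⟩ := Nat.exists_eq_add_of_le hn
        rw [pow_add, mul_comm (f ^ N), mul_assoc, map_mul, map_mul, map_pow _ f N]
        exact Ideal.mul_mem_left _ _ hN
      choose! N hN using fun (V : X.affineOpens) (h : V ∈ 𝓑 ∧ V.1 ≤ U.1) ↦ hpow V h.1 h.2
      -- The largest exponent over the finite cover `t` works on every `V` in `𝓑`, since membership
      -- is local and `V` is covered by small opens inside members of `t`.
      refine ⟨f ^ t.sup N, ⟨_, rfl⟩, (mem_J _ _).mpr fun V hV hVU ↦ ?_⟩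
      refine mem_K_of_forall V hV _ fun x hx ↦ ?_
      obtain ⟨W, hW, hxW⟩ := htU x (hVU hx)
      obtain ⟨W', hW', hxW', hle⟩ := small x (V.1 ⊓ W.1) ⟨hx, hxW⟩
      refine ⟨W', hle.trans inf_le_left, hxW', ?_⟩
      rw [res_res, ← hK W' W (hle.trans inf_le_right) (ht W hW).1,
        ← res_res (ht W hW).2 (hle.trans inf_le_right)]
      exact Ideal.mem_map_of_mem _ (hN W (ht W hW) _ (Finset.le_sup hW))
  exact ⟨⟨J, key, _, rfl⟩, J_eq⟩

/-- The sections over `V` whose pullback along `f` lie in `I`. -/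
noncomputable def sectionsIdeal {Y : Scheme.{u}} (f : Y ⟶ X) [IsOpenImmersion f]
    (I : Y.IdealSheafData) (V : X.affineOpens) (h : V.1 ≤ f.opensRange) : Ideal Γ(X, V) :=
  (I.ideal ⟨f ⁻¹ᵁ V, V.2.preimage_of_isOpenImmersion f h⟩).comap (f.app V).hom

lemma mem_sectionsIdeal {Y : Scheme.{u}} {f : Y ⟶ X} [IsOpenImmersion f]
    {I : Y.IdealSheafData} {V : X.affineOpens} {h : V.1 ≤ f.opensRange} (U : Y.affineOpens)
    (hU : U.1 = f ⁻¹ᵁ V) (s : Γ(X, V)) :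
    s ∈ sectionsIdeal f I V h ↔ (f.appLE V U hU.le).hom s ∈ I.ideal U := by
  obtain rfl : U = ⟨f ⁻¹ᵁ V, V.2.preimage_of_isOpenImmersion f h⟩ := Subtype.ext hU
  rw [Scheme.Hom.appLE_eq_app]
  rfl

/-- As `V` lies in the range of `g`, the map `a` identifies the preimages of `V` in `Y'` and `Y`.
This is what makes the ideal independent of the chart used to compute it. -/
lemma sectionsIdeal_comap {Y Y' : Scheme.{u}} (f : Y ⟶ X) (g : Y' ⟶ X) (a : Y' ⟶ Y)
    [IsOpenImmersion f] [IsOpenImmersion g] [IsOpenImmersion a] (hag : a ≫ f = g)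
    (I : Y.IdealSheafData) (V : X.affineOpens) (hf : V.1 ≤ f.opensRange)
    (hg : V.1 ≤ g.opensRange) :
    sectionsIdeal g (I.comap a) V hg = sectionsIdeal f I V hf := by
  subst hag
  ext s
  let W : Y'.affineOpens := ⟨(a ≫ f) ⁻¹ᵁ V, V.2.preimage_of_isOpenImmersion _ hg⟩
  have hW : (a ''ᵁ W.1) = f ⁻¹ᵁ V := by
    rw [show W.1 = a ⁻¹ᵁ f ⁻¹ᵁ V from rfl, Scheme.Hom.image_preimage_eq_opensRange_inf,
      inf_eq_right]
    intro y hy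
    obtain ⟨z, hz⟩ := hg hy
    exact ⟨z, f.isOpenEmbedding.injective hz⟩
  rw [mem_sectionsIdeal W rfl,
    mem_sectionsIdeal ⟨a ''ᵁ W.1, W.2.image_of_isOpenImmersion a⟩ hW,
    Scheme.IdealSheafData.ideal_comap_of_isOpenImmersion, Ideal.mem_comap]
  rw [← CommRingCat.comp_apply]
  have : (a ≫ f).appLE V W le_rfl ≫ (a.appIso W.1).inv = f.appLE V (a ''ᵁ W.1) hW.le := by
    rw [← cancel_mono (a.appIso W.1).hom]
    simp [Scheme.Hom.appIso_hom', Scheme.Hom.appLE_comp_appLE]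
  rw [this]

lemma sectionsIdeal_comap_self {Y : Scheme.{u}} (f : Y ⟶ X) [IsOpenImmersion f]
    (J : X.IdealSheafData) (V : X.affineOpens) (h : V.1 ≤ f.opensRange) :
    sectionsIdeal f (J.comap f) V h = J.ideal V := by
  rw [sectionsIdeal_comap (𝟙 X) f f (by simp) J V
    (by rw [Scheme.Hom.opensRange_of_isIso]; exact le_top)]
  ext s
  rw [mem_sectionsIdeal V rfl]
  exact (congr_arg (· ∈ J.ideal V) (res_self le_rfl s)).to_iff

/-- Over opens in the range of `f` the maps `f.app` are isomorphisms, which transport the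
compatibility of `I` with restriction. -/
lemma map_sectionsIdeal {Y : Scheme.{u}} (f : Y ⟶ X) [IsOpenImmersion f]
    (I : Y.IdealSheafData) (V W : X.affineOpens) (h : V.1 ≤ W.1) (hW : W.1 ≤ f.opensRange) :
    (sectionsIdeal f I W hW).map (res h) = sectionsIdeal f I V (h.trans hW) := by
  have := f.isIso_app W hW
  have := f.isIso_app V (h.trans hW)
  let eW := (asIso (f.app W)).commRingCatIsoToRingEquiv
  let eV := (asIso (f.app V)).commRingCatIsoToRingEquiv
  have hle : f ⁻¹ᵁ V ≤ f ⁻¹ᵁ W := f.preimage_mono h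
  have hI := I.map_ideal (U := ⟨f ⁻¹ᵁ V, V.2.preimage_of_isOpenImmersion f (h.trans hW)⟩)
    (V := ⟨f ⁻¹ᵁ W, W.2.preimage_of_isOpenImmersion f hW⟩) hle
  change Ideal.map (res h) (Ideal.comap eW.toRingHom _) = Ideal.comap eV.toRingHom _
  rw [← hI]
  generalize I.ideal _ = L
  have e₁ : L.comap eW.toRingHom = L.map eW.symm.toRingHom := (Ideal.map_symm eW).symm
  have e₂ (L') : Ideal.comap eV.toRingHom L' = L'.map eV.symm.toRingHom := (Ideal.map_symm eV).symm
  rw [e₁, e₂, Ideal.map_map, Ideal.map_map]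
  congr 1
  ext t
  obtain ⟨s, rfl⟩ := eW.surjective t
  change res h (eW.symm (eW s)) = eV.symm (res hle (eW s))
  rw [RingEquiv.symm_apply_apply, RingEquiv.eq_symm_apply]
  exact congr($(f.naturality (homOfLE h).op).hom s)

lemma bijective_appLE {Y : Scheme.{u}} (f : Y ⟶ X) [IsOpenImmersion f] {U : Y.Opens} {V : X.Opens}
    (hU : U = f ⁻¹ᵁ V) (hV : V ≤ f.opensRange) : Function.Bijective (f.appLE V U hU.le).hom := by
  subst hU
  have := f.isIso_app V hV
  rw [Scheme.Hom.appLE_eq_app]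
  exact ConcreteCategory.bijective_of_isIso (f.app V)

lemma comap_eq_of_sectionsIdeal_eq {Y : Scheme.{u}} (f : Y ⟶ X) [IsOpenImmersion f]
    (I : Y.IdealSheafData) (J : X.IdealSheafData)
    (h : ∀ (V : X.affineOpens) (hV : V.1 ≤ f.opensRange), J.ideal V = sectionsIdeal f I V hV) :
    J.comap f = I := by
  refine Scheme.IdealSheafData.ext (funext fun U ↦ ?_)
  have hU : U.1 = f ⁻¹ᵁ f ''ᵁ U.1 := (f.preimage_image_eq U.1).symm
  let V : X.affineOpens := ⟨f ''ᵁ U.1, U.2.image_of_isOpenImmersion f⟩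
  have hV : V.1 ≤ f.opensRange := f.image_le_opensRange _
  have key := (sectionsIdeal_comap_self f J V hV).trans (h V hV)
  have := f.isIso_app V hV
  ext s
  obtain ⟨t, rfl⟩ : ∃ t, (f.appLE V U hU.le).hom t = s :=
    (bijective_appLE f hU hV).2 s
  rw [← mem_sectionsIdeal U hU (h := hV), ← mem_sectionsIdeal U hU (h := hV), key]

/-- Quasi-coherent ideal sheaves glue along open covers. -/
lemma existsUnique_glue_idealSheafData {ι : Type*} {Y : ι → Scheme.{u}} (f : ∀ i, Y i ⟶ X)
    [∀ i, IsOpenImmersion (f i)] (hf : ∀ x, ∃ i, x ∈ (f i).opensRange)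
    (I : ∀ i, (Y i).IdealSheafData)
    (hI : ∀ i j (W : Scheme.{u}) (a : W ⟶ Y i) (c : W ⟶ Y j), a ≫ f i = c ≫ f j →
      (I i).comap a = (I j).comap c) :
    ∃! J : X.IdealSheafData, ∀ i, J.comap (f i) = I i := by
  let 𝓑 : Set X.affineOpens := {V | ∃ i, V.1 ≤ (f i).opensRange}
  -- The compatibility `hI` is applied to `V` itself, mapped to `Y i` and `Y j` by lifting its
  -- inclusion.
  have indep (i j) (V : X.affineOpens) (hi : V.1 ≤ (f i).opensRange)
      (hj : V.1 ≤ (f j).opensRange) :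
      sectionsIdeal (f i) (I i) V hi = sectionsIdeal (f j) (I j) V hj := by
    have hi' : Set.range V.1.ι ⊆ Set.range (f i) := by
      rw [Scheme.Opens.range_ι]; exact hi
    have hj' : Set.range V.1.ι ⊆ Set.range (f j) := by
      rw [Scheme.Opens.range_ι]; exact hj
    have ei : IsOpenImmersion.lift (f i) V.1.ι hi' ≫ f i = V.1.ι := IsOpenImmersion.lift_fac _ _ _
    have ej : IsOpenImmersion.lift (f j) V.1.ι hj' ≫ f j = V.1.ι := IsOpenImmersion.lift_fac _ _ _
    have : IsOpenImmersion (IsOpenImmersion.lift (f i) V.1.ι hi' ≫ f i) := by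
      rw [ei]; infer_instance
    have : IsOpenImmersion (IsOpenImmersion.lift (f j) V.1.ι hj' ≫ f j) := by
      rw [ej]; infer_instance
    have := IsOpenImmersion.of_comp (IsOpenImmersion.lift (f i) V.1.ι hi') (f i)
    have := IsOpenImmersion.of_comp (IsOpenImmersion.lift (f j) V.1.ι hj') (f j)
    rw [← sectionsIdeal_comap (f i) V.1.ι _ ei (I i) V hi (by simp),
      ← sectionsIdeal_comap (f j) V.1.ι _ ej (I j) V hj (by simp)]
    congr 1
    exact hI _ _ _ _ _ (ei.trans ej.symm)
  classical
  -- The value `⊤` outside `𝓑` is never used.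
  let K (V : X.affineOpens) : Ideal Γ(X, V) :=
    if h : V ∈ 𝓑 then sectionsIdeal (f h.choose) (I h.choose) V h.choose_spec else ⊤
  have hKi (V : X.affineOpens) (j) (hj : V.1 ≤ (f j).opensRange) :
      K V = sectionsIdeal (f j) (I j) V hj := by
    have hV : V ∈ 𝓑 := ⟨j, hj⟩
    simp only [K, dif_pos hV]
    exact indep _ _ _ _ _
  have hcov (x : X) : ∃ V ∈ 𝓑, x ∈ V.1 := by
    obtain ⟨i, hi⟩ := hf x
    obtain ⟨V, hV, hxV, hVi⟩ := exists_isAffineOpen_mem_and_subset hi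
    exact ⟨⟨V, hV⟩, ⟨i, hVi⟩, hxV⟩
  obtain ⟨J, hJ⟩ := exists_idealSheafData 𝓑 hcov (fun V W h ⟨i, hi⟩ ↦ ⟨i, le_trans h hi⟩) K
    (fun V W h ⟨i, hi⟩ ↦ by
      rw [hKi W i hi, hKi V i (h.trans hi), map_sectionsIdeal])
  refine ⟨J, fun i ↦ ?_, fun J' hJ' ↦ ?_⟩
  · refine comap_eq_of_sectionsIdeal_eq _ _ _ fun V hV ↦ ?_
    rw [hJ V ⟨i, hV⟩, hKi V i hV]
  · refine Scheme.IdealSheafData.ext_of_iSup_eq_top (fun V : 𝓑 ↦ V.1) ?_ fun ⟨V, i, hi⟩ ↦ ?_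
    · refine top_le_iff.mp fun x _ ↦ ?_
      obtain ⟨V, hV, hx⟩ := hcov x
      exact TopologicalSpace.Opens.mem_iSup.mpr ⟨⟨V, hV⟩, hx⟩
    · rw [hJ V ⟨i, hi⟩, hKi V i hi, ← hJ' i, sectionsIdeal_comap_self]

end IdealSheaf

/-! ### Representability of presheaves on `S`-schemes by open charts -/

section OverRepresentability

open Opposite

variable {S : Scheme.{u}} (F : (Over S)ᵒᵖ ⥤ Type u)

/-- The sections of `F` over `T`, for varying structure morphism `T ⟶ S`. -/
abbrev TotalSections (T : Scheme.{u}) : Type u := Σ g : T ⟶ S, F.obj (op (Over.mk g))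

variable {F}

/-- A morphism over the identity of `T` takes the place of a transport along the equality of
structure morphisms. -/
lemma TotalSections.ext_of_map {T : Scheme.{u}} {p q : TotalSections F T}
    (a : Over.mk p.1 ⟶ Over.mk q.1) (ha : a.left = 𝟙 T) (h : F.map a.op q.2 = p.2) : p = q := by
  obtain ⟨g, x⟩ := p
  obtain ⟨g', x'⟩ := q
  obtain rfl : g = g' := by simpa [ha] using (Over.w a).symm
  obtain rfl : a = 𝟙 _ := Over.OverMorphism.ext ha
  obtain rfl : x' = x := by
    refine Eq.trans ?_ h
    exact (congr($(F.map_id _) x')).symm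
  rfl

lemma map_map_apply {T T' T'' : Over S} (a : T ⟶ T') (c : T' ⟶ T'') (x : F.obj (op T'')) :
    F.map a.op (F.map c.op x) = F.map (a ≫ c).op x := by
  rw [op_comp, F.map_comp]
  rfl

lemma map_id_apply {T : Over S} (x : F.obj (op T)) : F.map (𝟙 T).op x = x :=
  congr($(F.map_id _) x)

/-- The pullback of a section along a morphism of schemes. -/
noncomputable def TotalSections.map {T T' : Scheme.{u}} (h : T' ⟶ T) (p : TotalSections F T) :
    TotalSections F T' :=
  ⟨h ≫ p.1, F.map (Over.homMk (U := Over.mk (h ≫ p.1)) (V := Over.mk p.1) h).op p.2⟩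

lemma TotalSections.eq_map {T T' : Scheme.{u}} {h : T' ⟶ T} {p : TotalSections F T}
    {q : TotalSections F T'} (a : Over.mk q.1 ⟶ Over.mk p.1) (ha : a.left = h)
    (h' : F.map a.op p.2 = q.2) : q = p.map h := by
  have h₁ : q.1 = h ≫ p.1 := by rw [← ha]; exact (Over.w a).symm
  refine TotalSections.ext_of_map
    (Over.homMk (U := Over.mk q.1) (V := Over.mk (h ≫ p.1)) (𝟙 _)
      ((Category.id_comp _).trans h₁.symm)) rfl ?_
  refine (map_map_apply _ _ _).trans (Eq.trans ?_ h')
  refine congrArg (fun c : _ ⟶ _ ↦ F.map (Quiver.Hom.op c) p.2) (Over.OverMorphism.ext ?_)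
  exact (Category.id_comp h).trans ha.symm

lemma TotalSections.map_eq_of_eq_map {T T' : Scheme.{u}} {h : T' ⟶ T} {p : TotalSections F T}
    {q : TotalSections F T'} (hq : p.map h = q) (a : Over.mk q.1 ⟶ Over.mk p.1)
    (ha : a.left = h) : F.map a.op p.2 = q.2 := by
  subst hq
  exact congrArg (fun c : _ ⟶ _ ↦ F.map (Quiver.Hom.op c) p.2) (Over.OverMorphism.ext ha)

variable (F) in
/-- The presheaf on schemes obtained from a presheaf on `S`-schemes by letting the structure
morphism vary. -/
noncomputable def totalFunctor : Scheme.{u}ᵒᵖ ⥤ Type u where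
  obj T := TotalSections F T.unop
  map h := ↾TotalSections.map h.unop
  map_id T := by
    ext p : 3
    exact (TotalSections.eq_map (p := p) (q := p) (𝟙 _) rfl (map_id_apply _)).symm
  map_comp h h' := by
    ext p : 3
    refine (TotalSections.eq_map (p := p) (q := (p.map h.unop).map h'.unop)
      (Over.homMk (h'.unop ≫ h.unop) (Category.assoc _ _ _)) rfl ?_).symm
    refine Eq.trans ?_ (map_map_apply _ _ _).symm
    exact congrArg (fun c : _ ⟶ _ ↦ F.map (Quiver.Hom.op c) p.2) (Over.OverMorphism.ext rfl)

/-- The condition that compatible sections of `F` over an open cover glue uniquely. -/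
def HasUniqueGluing (F : (Over S)ᵒᵖ ⥤ Type u) : Prop :=
  -- The universe of `ι` accommodates the open covers extracted from covering presieves in
  -- `HasUniqueGluing.isSheaf`.
  ∀ (T : Over S) (ι : Type (u + 1)) (Y : ι → Over S) (f : ∀ i, Y i ⟶ T),
    (∀ i, IsOpenImmersion (f i).left) → (∀ t : T.left, ∃ i, ∃ y, (f i).left y = t) →
    ∀ x : ∀ i, F.obj (op (Y i)),
    (∀ i j (W : Over S) (a : W ⟶ Y i) (c : W ⟶ Y j), a ≫ f i = c ≫ f j →
      F.map a.op (x i) = F.map c.op (x j)) →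
    ∃! y : F.obj (op T), ∀ i, F.map (f i).op y = x i

/-- The structure morphisms to `S` glue first; over the resulting `S`-scheme the sections of `F`
glue by hypothesis. -/
lemma HasUniqueGluing.isSheaf (hF : HasUniqueGluing F) :
    Presheaf.IsSheaf Scheme.zariskiTopology (totalFunctor F) := by
  rw [isSheaf_iff_isSheaf_of_type, Precoverage.isSheaf_toGrothendieck_iff_of_isStableUnderBaseChange]
  intro T R hR
  obtain ⟨(𝒰 : T.OpenCover), rfl⟩ := Scheme.exists_cover_of_mem_pretopology hR
  rw [Presieve.isSheafFor_arrows_iff]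
  intro x hx
  have hx' (i j) (W : Scheme.{u}) (a : W ⟶ 𝒰.X i) (c : W ⟶ 𝒰.X j)
      (h : a ≫ 𝒰.f i = c ≫ 𝒰.f j) :
    TotalSections.map a (x i) = TotalSections.map c (x j) := hx i j W a c h
  have hx₁ (i j) (W : Scheme.{u}) (a : W ⟶ 𝒰.X i) (c : W ⟶ 𝒰.X j)
      (h : a ≫ 𝒰.f i = c ≫ 𝒰.f j) : a ≫ (x i).1 = c ≫ (x j).1 :=
    congrArg Sigma.fst (hx' i j W a c h)
  let g : T ⟶ S := 𝒰.glueMorphisms (fun i ↦ (x i).1) fun i j ↦ hx₁ _ _ _ _ _ pullback.condition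
  have hg (i) : 𝒰.f i ≫ g = (x i).1 := 𝒰.ι_glueMorphisms _ _ i
  obtain ⟨y, hy, hy'⟩ := hF (Over.mk g) 𝒰.I₀ (fun i ↦ Over.mk (x i).1)
    (fun i ↦ Over.homMk (𝒰.f i) (hg i)) (fun i ↦ inferInstanceAs (IsOpenImmersion (𝒰.f i)))
    (fun t ↦ ⟨_, 𝒰.covers t⟩) (fun i ↦ (x i).2) (fun i j W a c h ↦ by
      have := hx' i j W.left a.left c.left congr($(h).left)
      have h₁ := TotalSections.map_eq_of_eq_map (p := x i) (h := a.left)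
        (q := ⟨W.hom, F.map a.op (x i).2⟩)
        (TotalSections.eq_map (p := x i) (q := ⟨W.hom, F.map a.op (x i).2⟩) a rfl rfl).symm a rfl
      exact h₁.trans (TotalSections.map_eq_of_eq_map (p := x j) (h := c.left)
        (q := ⟨W.hom, F.map a.op (x i).2⟩)
        (this.symm.trans
          (TotalSections.eq_map (p := x i) (q := ⟨W.hom, F.map a.op (x i).2⟩) a rfl rfl).symm)
        c rfl).symm)
  refine ⟨⟨g, y⟩, fun i ↦ ?_, fun z hz ↦ ?_⟩
  · exact (TotalSections.eq_map (p := ⟨g, y⟩) _ rfl (hy i)).symm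
  · have hzg : z.1 = g := 𝒰.hom_ext _ _ fun i ↦ (congrArg Sigma.fst (hz i)).trans (hg i).symm
    obtain ⟨z, w⟩ := z
    obtain rfl : z = g := hzg
    congr 1
    exact hy' _ fun i ↦ TotalSections.map_eq_of_eq_map (hz i) _ rfl

/-- A pair `(H, ξ)` represents an open subfunctor of `F`. -/
structure IsOpenChart (F : (Over S)ᵒᵖ ⥤ Type u) (H : Over S) (ξ : F.obj (op H)) : Prop where
  injective {T : Over S} (a c : T ⟶ H) : F.map a.op ξ = F.map c.op ξ → a = c
  exists_opens (T : Over S) (x : F.obj (op T)) : ∃ E : T.left.Opens,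
    ∀ (T' : Over S) (h : T' ⟶ T),
      (∃ a : T' ⟶ H, F.map a.op ξ = F.map h.op x) ↔ ∀ t, h.left t ∈ E

lemma TotalSections.map_comp {T T' T'' : Scheme.{u}} (h : T' ⟶ T) (h' : T'' ⟶ T')
    (p : TotalSections F T) : p.map (h' ≫ h) = (p.map h).map h' :=
  congr($((totalFunctor F).map_comp h.op h'.op) p)

lemma TotalSections.mk_map {T T' : Over S} (a : T' ⟶ T) (x : F.obj (op T)) :
    (⟨T'.hom, F.map a.op x⟩ : TotalSections F T'.left) =
      TotalSections.map a.left ⟨T.hom, x⟩ :=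
  TotalSections.eq_map (p := ⟨T.hom, x⟩) (q := ⟨T'.hom, F.map a.op x⟩) a rfl rfl

/-- The pullback of the chart along a section over `T` is the open `E`. Its map to `H` comes from
applying `exists_opens` to `E` itself, and injectivity of the chart shows that the square is
cartesian. -/
lemma IsOpenChart.isOpenImmersion {H : Over S} {ξ : F.obj (op H)} (hξ : IsOpenChart F H ξ) :
    IsOpenImmersion.presheaf
      (yonedaEquiv.symm (show (totalFunctor F).obj (op H.left) from ⟨H.hom, ξ⟩)) := by
  refine MorphismProperty.relative.of_exists fun T g ↦ ?_
  obtain ⟨p, rfl⟩ := yonedaEquiv.symm.surjective g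
  obtain ⟨E, hE⟩ := hξ.exists_opens (Over.mk p.1) p.2
  obtain ⟨a, ha⟩ := (hE (Over.mk (E.ι ≫ p.1)) (Over.homMk E.ι)).mpr fun t ↦ t.2
  refine ⟨E, yoneda.map a.left, E.ι, ?_, inferInstance⟩
  refine IsPullback.of_forall_isPullback_app fun ⟨T'⟩ ↦ ?_
  rw [Types.isPullback_iff]
  refine ⟨?_, ?_, ?_⟩
  · ext c
    change TotalSections.map (c ≫ a.left) ⟨H.hom, ξ⟩ = TotalSections.map (c ≫ E.ι) p
    refine (TotalSections.map_comp _ _ _).trans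
      ((congrArg _ ?_).trans (TotalSections.map_comp _ _ _).symm)
    refine (TotalSections.mk_map a ξ).symm.trans ?_
    rw [ha]
    exact TotalSections.mk_map (T := Over.mk p.1) _ p.2
  · rintro x y ⟨-, h⟩
    exact (cancel_mono E.ι).mp h
  · intro (b : T' ⟶ H.left) (c : T' ⟶ T) h
    replace h : TotalSections.map b ⟨H.hom, ξ⟩ = p.map c := h
    have hb : b ≫ H.hom = c ≫ p.1 := congrArg Sigma.fst h
    let b' : Over.mk (c ≫ p.1) ⟶ H := Over.homMk b hb
    let c' : Over.mk (c ≫ p.1) ⟶ Over.mk p.1 := Over.homMk c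
    have hbc : F.map b'.op ξ = F.map c'.op p.2 :=
      TotalSections.map_eq_of_eq_map (p := ⟨H.hom, ξ⟩) h b' rfl
    have hc := (hE _ c').mp ⟨b', hbc⟩
    have hr : Set.range c ⊆ Set.range E.ι := by
      rintro _ ⟨t, rfl⟩
      exact ⟨⟨_, hc t⟩, rfl⟩
    let l : T' ⟶ E := IsOpenImmersion.lift E.ι c hr
    have hl : l ≫ E.ι = c := IsOpenImmersion.lift_fac _ _ _
    let l' : Over.mk (c ≫ p.1) ⟶ Over.mk (E.ι ≫ p.1) := Over.homMk l (by simp [reassoc_of% hl])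
    refine ⟨l, ?_, hl⟩
    refine congrArg Over.Hom.left (hξ.injective (l' ≫ a) b' ?_)
    rw [hbc, ← map_map_apply, ha, map_map_apply]
    exact congrArg (fun c : _ ⟶ _ ↦ F.map (Quiver.Hom.op c) p.2) (Over.OverMorphism.ext hl)

/-- The local criterion concerns presheaves on all schemes, hence the detour through `totalFunctor`.
If `u` is a universal section over `M`, then `u.1` makes `M` an `S`-scheme and `u.2` is universal
for `F`. -/
lemma isRepresentable_of_isOpenChart (hF : HasUniqueGluing F) {ι : Type u} (H : ι → Over S)
    (ξ : ∀ i, F.obj (op (H i))) (hξ : ∀ i, IsOpenChart F (H i) (ξ i))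
    (hcov : ∀ (T : Over S) (x : F.obj (op T)) (t : T.left), ∃ (i : ι) (T' : Over S) (h : T' ⟶ T)
      (a : T' ⟶ H i), IsOpenImmersion h.left ∧ (∃ t', h.left t' = t) ∧
        F.map a.op (ξ i) = F.map h.op x) : F.IsRepresentable := by
  let G : Sheaf Scheme.zariskiTopology (Type u) := ⟨totalFunctor F, hF.isSheaf⟩
  let f (i : ι) : yoneda.obj (H i).left ⟶ G.1 :=
    yonedaEquiv.symm (show (totalFunctor F).obj (op (H i).left) from ⟨(H i).hom, ξ i⟩)
  have hf (i) : IsOpenImmersion.presheaf (f i) := (hξ i).isOpenImmersion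
  have : Presheaf.IsLocallySurjective Scheme.zariskiTopology (Sigma.desc f) := by
    refine ⟨fun {T} p ↦ ?_⟩
    choose i T' h a h₁ h₂ h₃ using hcov (Over.mk p.1) p.2
    let 𝒰 : T.OpenCover := Scheme.Cover.mkOfCovers (P := @IsOpenImmersion) T
      (fun t ↦ (T' t).left) (fun t ↦ (h t).left) (fun t ↦ ⟨t, h₂ t⟩) h₁
    refine Scheme.mem_grothendieckTopology_iff.mpr ⟨𝒰, ?_⟩
    rintro _ _ ⟨t⟩
    refine ⟨(Sigma.ι (fun i ↦ yoneda.obj (H i).left) (i t)).app _ (a t).left, ?_⟩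
    refine (congr($(Sigma.ι_desc f (i t)).app (op (T' t).left) (a t).left)).trans ?_
    refine (TotalSections.mk_map (a t) _).symm.trans ?_
    refine (congrArg (Sigma.mk (T' t).hom) (h₃ t)).trans ?_
    exact TotalSections.mk_map (T := Over.mk p.1) _ p.2
  have : (totalFunctor F).IsRepresentable :=
    Scheme.LocalRepresentability.isRepresentable hf
  obtain ⟨M, ⟨r⟩⟩ := this
  obtain ⟨u, hu⟩ : ∃ u : TotalSections F M, u = r.homEquiv (𝟙 M) := ⟨_, rfl⟩
  have hr {T : Scheme.{u}} (a : T ⟶ M) : r.homEquiv a = u.map a := by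
    rw [hu, r.homEquiv_eq]
    rfl
  have hbij (T : Over S) :
      Function.Bijective fun a : T ⟶ Over.mk u.1 ↦ F.map a.op u.2 := by
    refine ⟨fun a c hac ↦ Over.OverMorphism.ext (r.homEquiv.injective ?_), fun x ↦ ?_⟩
    · rw [hr, hr]
      refine (TotalSections.mk_map a u.2).symm.trans (Eq.trans ?_ (TotalSections.mk_map c u.2))
      exact congrArg _ hac
    · obtain ⟨b, hb⟩ := r.homEquiv.surjective (show (totalFunctor F).obj (op T.left) from ⟨T.hom, x⟩)
      rw [hr] at hb
      exact ⟨Over.homMk b (congrArg Sigma.fst hb),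
        TotalSections.map_eq_of_eq_map hb _ rfl⟩
  exact ⟨Over.mk u.1, ⟨⟨Equiv.ofBijective _ (hbij _), fun a c ↦ (map_map_apply a c u.2).symm⟩⟩⟩

end OverRepresentability

/-! ### The Hilbert functor is a Zariski sheaf -/

section Gluing

lemma RingHomFreeOfRank.of_comp_bijective {A B B' : Type u} [CommRing A] [CommRing B]
    [CommRing B'] {φ : A →+* B} {e : B →+* B'} (he : Function.Bijective e) {d : ℕ}
    (h : RingHomFreeOfRank (e.comp φ) d) : RingHomFreeOfRank φ d := by
  obtain ⟨v, hv⟩ := h.exists_isBasisVia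
  choose w hw using fun i ↦ he.2 (v i)
  refine IsBasisVia.freeOfRank (v := w) ?_
  rw [IsBasisVia, ← Function.Bijective.of_comp_iff' he]
  have : (e ∘ fun c : Fin d → A ↦ ∑ i, φ (c i) * w i) =
      fun c ↦ ∑ i, (e.comp φ) (c i) * v i := by
    ext c
    simp [hw]
  rw [this]
  exact hv

lemma isZariskiLocalAtTarget_isFinite : IsZariskiLocalAtTarget @IsFinite.{u} :=
  @HasAffineProperty.instIsZariskiLocalAtTarget _ _
    IsFinite.instHasAffinePropertyAndIsAffineFiniteCarrierObjOppositeOpensCarrierCarrierCommRingCatPresheafOpOpensTopHomAppTop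

lemma IsFiniteFlatOfRank.of_morphismRestrict {Z T : Scheme.{u}} (π : Z ⟶ T) (d : ℕ) {ι : Type*}
    (U : ι → T.Opens) (hU : ∀ t, ∃ i, t ∈ U i) (h : ∀ i, IsFiniteFlatOfRank (π ∣_ U i) d) :
    IsFiniteFlatOfRank π d := by
  refine ⟨?_, fun t ↦ ?_⟩
  · have := isZariskiLocalAtTarget_isFinite.{u}
    exact IsZariskiLocalAtTarget.of_iSup_eq_top (P := @IsFinite) U
      (top_le_iff.mp fun t _ ↦ TopologicalSpace.Opens.mem_iSup.mpr (hU t)) fun i ↦ (h i).1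
  · obtain ⟨i, hi⟩ := hU t
    obtain ⟨V, hV, htV, hfr⟩ := (h i).2 ⟨t, hi⟩
    refine ⟨(U i).ι ''ᵁ V, hV.image_of_isOpenImmersion _, ⟨⟨t, hi⟩, htV, rfl⟩, ?_⟩
    rw [morphismRestrict_app] at hfr
    exact RingHomFreeOfRank.of_comp_bijective (e := (Z.presheaf.map (eqToHom
      (image_morphismRestrict_preimage π (U i) V)).op).hom)
      (ConcreteCategory.bijective_of_isIso _) hfr

lemma IsFiniteFlatOfRank.of_cover {Z T : Scheme.{u}} (π : Z ⟶ T) (d : ℕ) {ι : Type*}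
    {Y W : ι → Scheme.{u}} (f : ∀ i, Y i ⟶ T) [∀ i, IsOpenImmersion (f i)]
    (hf : ∀ t, ∃ i, ∃ y, f i y = t) (g : ∀ i, W i ⟶ Z) (q : ∀ i, W i ⟶ Y i)
    (hq : ∀ i, IsPullback (g i) (q i) π (f i)) (h : ∀ i, IsFiniteFlatOfRank (q i) d) :
    IsFiniteFlatOfRank π d := by
  refine .of_morphismRestrict π d (fun i ↦ (f i).opensRange) hf fun i ↦ ?_
  have h₁ := (isPullback_morphismRestrict π (f i).opensRange).flip
  have e : IsOpenImmersion.lift (f i) (f i).opensRange.ι (by simp) ≫ f i =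
    (f i).opensRange.ι := IsOpenImmersion.lift_fac _ _ _
  rw [← e] at h₁
  exact (h i).of_isPullback (IsPullback.of_right' h₁ (hq i))

lemma exists_preimage_of_isPullback {X Y X' Y' : Scheme.{u}} {g' : X' ⟶ X} {f' : X' ⟶ Y'}
    {f : X ⟶ Y} {g : Y' ⟶ Y} (h : IsPullback g' f' f g) (x : X) (y : Y') (hxy : f x = g y) :
    ∃ z : X', g' z = x ∧ f' z = y := by
  obtain ⟨z, hz, hz'⟩ := Scheme.Pullback.exists_preimage_pullback x y hxy
  refine ⟨h.isoPullback.inv z, ?_, ?_⟩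
  · rw [← Scheme.Hom.comp_apply, h.isoPullback_inv_fst, hz]
  · rw [← Scheme.Hom.comp_apply, h.isoPullback_inv_snd, hz']

lemma isOpenImmersion_baseChangeMap {X S : Scheme.{u}} (f : X ⟶ S) {T' T : Over S} (h : T' ⟶ T)
    (hh : IsOpenImmersion h.left) : IsOpenImmersion (baseChangeMap f h) :=
  MorphismProperty.of_isPullback (isPullback_baseChangeMap f h).flip hh

lemma isPullback_subscheme_comap {X S : Scheme.{u}} (f : X ⟶ S) {T' T : Over S} (h : T' ⟶ T)
    (I : (pullback f T.hom).IdealSheafData) :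
    IsPullback ((I.comapIso (baseChangeMap f h)).hom ≫ pullback.snd _ _)
      ((I.comap (baseChangeMap f h)).subschemeι ≫ pullback.snd f T'.hom)
      (I.subschemeι ≫ pullback.snd f T.hom) h.left := by
  have h₁ : IsPullback ((I.comapIso (baseChangeMap f h)).hom ≫ pullback.snd _ _)
      (I.comap (baseChangeMap f h)).subschemeι I.subschemeι (baseChangeMap f h) :=
    (IsPullback.of_hasPullback (baseChangeMap f h) I.subschemeι).flip.of_iso
      (I.comapIso (baseChangeMap f h)).symm (Iso.refl _) (Iso.refl _) (Iso.refl _)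
      (by rw [Iso.symm_hom, Iso.inv_hom_id_assoc]; simp) (by simp) (by simp) (by simp)
  exact h₁.paste_vert (isPullback_baseChangeMap f h)

/-- The base changes of `X` to the members of the cover form an open cover of `X ×_S T`, so the
ideals glue. Being finite flat of rank `d` is local on the target. -/
lemma hasUniqueGluing_hilbertFunctor {X S : Scheme.{u}} (f : X ⟶ S) (d : ℕ) :
    HasUniqueGluing (hilbertFunctor f d) := by
  intro T ι Y j hj hcov x hx
  have (i : ι) := isOpenImmersion_baseChangeMap f (j i) (hj i)
  have hcov' (z : ↑(pullback f T.hom)) :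
      ∃ i, z ∈ (baseChangeMap f (j i)).opensRange := by
    obtain ⟨i, y, hy⟩ := hcov ((pullback.snd f T.hom) z)
    obtain ⟨w, hw, -⟩ := exists_preimage_of_isPullback (isPullback_baseChangeMap f (j i)) _ _ hy.symm
    exact ⟨i, w, hw⟩
  obtain ⟨J, hJ, hJ'⟩ := existsUnique_glue_idealSheafData (fun i ↦ baseChangeMap f (j i)) hcov'
    (fun i ↦ (x i).1) (fun i i' W a c hac ↦ by
      -- Gluing ideals requires compatibility on an arbitrary `W` over both charts, whereas `hx`
      -- gives it on `X ×_S W'`. The map `m`, a graph, satisfies `m ≫ baseChangeMap f a' = a` and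
      -- likewise for `c`, so pulling back along `m` suffices.
      let W' : Over S := Over.mk (a ≫ pullback.snd _ _ ≫ (Y i).hom)
      let a' : W' ⟶ Y i := Over.homMk (a ≫ pullback.snd _ _) (by simp [W'])
      have hsnd : (a ≫ pullback.snd _ _) ≫ (j i).left = (c ≫ pullback.snd _ _) ≫ (j i').left := by
        simpa using congr($hac ≫ pullback.snd _ _)
      have hfst : a ≫ pullback.fst _ _ = c ≫ pullback.fst _ _ := by
        simpa using congr($hac ≫ pullback.fst _ _)
      have hw : (c ≫ pullback.snd _ _) ≫ (Y i').hom = a ≫ pullback.snd _ _ ≫ (Y i).hom := by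
        have := congr($hsnd ≫ T.hom)
        simp only [Category.assoc, Over.w] at this ⊢
        exact this.symm
      let c' : W' ⟶ Y i' := Over.homMk (c ≫ pullback.snd _ _) hw
      have h := congrArg Subtype.val (hx i i' W' a' c' (Over.OverMorphism.ext hsnd))
      have hm : (a ≫ pullback.fst f (Y i).hom) ≫ f = 𝟙 W ≫ W'.hom := by
        simp [W', pullback.condition]
      let m : W ⟶ pullback f W'.hom := pullback.lift (a ≫ pullback.fst _ _) (𝟙 W) hm
      have hm₁ : m ≫ pullback.fst f W'.hom = a ≫ pullback.fst _ _ := pullback.lift_fst _ _ hm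
      have hm₂ : m ≫ pullback.snd f W'.hom = 𝟙 W := pullback.lift_snd _ _ hm
      have hma {V : Over S} (k : W' ⟶ V) (e : W ⟶ pullback f V.hom)
          (h₁ : e ≫ pullback.fst _ _ = a ≫ pullback.fst _ _)
          (h₂ : e ≫ pullback.snd _ _ = k.left) : m ≫ baseChangeMap f k = e := by
        apply pullback.hom_ext
        · rw [Category.assoc, baseChangeMap_fst, hm₁, h₁]
        · rw [Category.assoc, baseChangeMap_snd, h₂]
          exact (Category.assoc _ _ _).symm.trans ((congrArg (· ≫ k.left) hm₂).trans
            (Category.id_comp _))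
      have ha : m ≫ baseChangeMap f a' = a := hma _ _ rfl rfl
      have hc : m ≫ baseChangeMap f c' = c := hma _ _ hfst.symm rfl
      rw [← ha, ← hc, Scheme.IdealSheafData.comap_comp, Scheme.IdealSheafData.comap_comp]
      exact congrArg (fun I ↦ Scheme.IdealSheafData.comap I m) h)
  refine ⟨⟨J, ?_⟩, fun i ↦ Subtype.ext (hJ i), fun K hK ↦ Subtype.ext (hJ' _ fun i ↦
    congrArg Subtype.val (hK i))⟩
  refine .of_cover _ d (fun i ↦ (j i).left) hcov _ _ (fun i ↦ isPullback_subscheme_comap f (j i) J)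
    fun i ↦ ?_
  rw [hJ i]
  exact (x i).2

end Gluing

/-! ### The open locus where given functions form a basis -/

section Charts

lemma isPushout_app_of_isPullback {Z T Z' T' : Scheme.{u}} {g' : Z' ⟶ Z} {π' : Z' ⟶ T'}
    {π : Z ⟶ T} {g : T' ⟶ T} (h : IsPullback g' π' π g) [IsAffineHom π] {V : T.Opens}
    {V' : T'.Opens} (hV : IsAffineOpen V) (hV' : IsAffineOpen V') (hVV' : V' ≤ g ⁻¹ᵁ V)
    (hle : π' ⁻¹ᵁ V' ≤ g' ⁻¹ᵁ π ⁻¹ᵁ V) :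
    IsPushout (π.app V) (g.appLE V V' hVV') (g'.appLE (π ⁻¹ᵁ V) (π' ⁻¹ᵁ V') hle) (π'.app V') := by
  have hU : π' ⁻¹ᵁ V' = g' ⁻¹ᵁ (π ⁻¹ᵁ V) ⊓ π' ⁻¹ᵁ V' :=
    le_antisymm (le_inf hle le_rfl) inf_le_right
  have hp := (isIso_pushoutSection_iff h hVV' le_rfl hU).mp
    (isIso_pushoutSection_of_isAffineOpen h hVV' le_rfl hU hV hV' (hV.preimage π))
  rwa [← Scheme.Hom.app_eq_appLE, ← Scheme.Hom.app_eq_appLE] at hp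

lemma preimage_le_of_isPullback {Z T Z' T' : Scheme.{u}} {g' : Z' ⟶ Z} {π' : Z' ⟶ T'}
    {π : Z ⟶ T} {g : T' ⟶ T} (h : IsPullback g' π' π g) {V : T.Opens}
    {V' : T'.Opens} (hVV' : V' ≤ g ⁻¹ᵁ V) : π' ⁻¹ᵁ V' ≤ g' ⁻¹ᵁ π ⁻¹ᵁ V := by
  rw [← Scheme.Hom.comp_preimage, h.w, Scheme.Hom.comp_preimage]
  exact π'.preimage_mono hVV'

lemma comp_appLE_apply {Z' Z X : Scheme.{u}} (g' : Z' ⟶ Z) (p : Z ⟶ X) {U : X.Opens}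
    {V : Z.Opens} {W : Z'.Opens} (e : V ≤ p ⁻¹ᵁ U) (e' : W ≤ g' ⁻¹ᵁ V)
    (e'' : W ≤ (g' ≫ p) ⁻¹ᵁ U) (x : Γ(X, U)) :
    ((g' ≫ p).appLE U W e'').hom x = (g'.appLE V W e').hom ((p.appLE U V e).hom x) := by
  have h := Scheme.Hom.appLE_comp_appLE g' p U V W e e'
  exact congrArg (fun k ↦ k.hom x) h.symm

/-- Over the open subset `V` of `T`, the map `p` lands in `U`, the pullbacks of the functions `b`
form a basis of the functions on `Z`, and `c x` are the coefficients of the pullback of `x` in this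
basis. -/
structure HasCoefficients {Z X T : Scheme.{u}} (π : Z ⟶ T) (p : Z ⟶ X) {d : ℕ} {U : X.Opens}
    (b : Fin d → Γ(X, U)) (V : T.Opens) (c : Γ(X, U) → Fin d → Γ(T, V)) : Prop where
  le : π ⁻¹ᵁ V ≤ p ⁻¹ᵁ U
  basis : IsBasisVia (π.app V).hom ((p.appLE U (π ⁻¹ᵁ V) le).hom ∘ b)
  eq (x : Γ(X, U)) : (p.appLE U (π ⁻¹ᵁ V) le).hom x =
    ∑ i, (π.app V).hom (c x i) * (p.appLE U (π ⁻¹ᵁ V) le).hom (b i)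

variable {Z X T : Scheme.{u}} {π : Z ⟶ T} {p : Z ⟶ X} {d : ℕ} {U : X.Opens}
  {b : Fin d → Γ(X, U)} {V : T.Opens} {c : Γ(X, U) → Fin d → Γ(T, V)}

lemma HasCoefficients.exists_of_isBasisVia (le : π ⁻¹ᵁ V ≤ p ⁻¹ᵁ U)
    (hb : IsBasisVia (π.app V).hom ((p.appLE U (π ⁻¹ᵁ V) le).hom ∘ b)) :
    ∃ c, HasCoefficients π p b V c := by
  choose c hc using fun x : Γ(X, U) ↦ hb.2 ((p.appLE U (π ⁻¹ᵁ V) le).hom x)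
  exact ⟨c, le, hb, fun x ↦ (hc x).symm⟩

lemma HasCoefficients.unique {c' : Γ(X, U) → Fin d → Γ(T, V)} (h : HasCoefficients π p b V c)
    (h' : HasCoefficients π p b V c') : c = c' := by
  ext1 x
  exact h.basis.1 ((h.eq x).symm.trans (h'.eq x))

lemma HasCoefficients.isCoefficients {S : Scheme.{u}} {f : X ⟶ S} {τ : T ⟶ S}
    (hw : π ≫ τ = p ≫ f) (h : HasCoefficients π p b V c) {W : S.Opens} (hU : U ≤ f ⁻¹ᵁ W)
    (hV : V ≤ τ ⁻¹ᵁ W) :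
    IsCoefficients (f.appLE W U hU).hom (τ.appLE W V hV).hom b c := by
  refine IsBasisVia.isCoefficients ?_ h.basis h.eq
  have : f.appLE W U hU ≫ p.appLE U (π ⁻¹ᵁ V) h.le = τ.appLE W V hV ≫ π.app V := by
    rw [Scheme.Hom.appLE_comp_appLE, Scheme.Hom.app_eq_appLE, Scheme.Hom.appLE_comp_appLE]
    simp only [hw]
  exact congrArg CommRingCat.Hom.hom this

lemma HasCoefficients.of_isPullback {Z' T' : Scheme.{u}} {g' : Z' ⟶ Z} {π' : Z' ⟶ T'}
    {g : T' ⟶ T} (h : HasCoefficients π p b V c) (hp : IsPullback g' π' π g) [IsAffineHom π]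
    {V' : T'.Opens} (hV : IsAffineOpen V) (hV' : IsAffineOpen V') (hVV' : V' ≤ g ⁻¹ᵁ V) :
    HasCoefficients π' (g' ≫ p) b V' fun x i ↦ (g.appLE V V' hVV').hom (c x i) := by
  have hle := preimage_le_of_isPullback hp hVV'
  have hpo := isPushout_app_of_isPullback hp hV hV' hVV' hle
  have hle' : π' ⁻¹ᵁ V' ≤ (g' ≫ p) ⁻¹ᵁ U := hle.trans (g'.preimage_mono h.le)
  have key (x : Γ(X, U)) : ((g' ≫ p).appLE U (π' ⁻¹ᵁ V') hle').hom x =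
      (g'.appLE (π ⁻¹ᵁ V) (π' ⁻¹ᵁ V') hle).hom ((p.appLE U (π ⁻¹ᵁ V) h.le).hom x) :=
    comp_appLE_apply g' p h.le hle hle' x
  have hw (y : Γ(T, V)) : (g'.appLE (π ⁻¹ᵁ V) (π' ⁻¹ᵁ V') hle).hom ((π.app V).hom y) =
      (π'.app V').hom ((g.appLE V V' hVV').hom y) := congrArg (fun k ↦ k.hom y) hpo.w
  refine ⟨hle', ?_, fun x ↦ ?_⟩
  · have := IsBasisVia.of_isPushout hpo h.basis
    simpa only [Function.comp_def, key] using this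
  · rw [key, h.eq x, map_sum]
    simp only [map_mul, hw, key]

variable (π p b) in
/-- The locus of points in `T` around which the functions `b` induce a basis of `Z`. -/
def locus : T.Opens where
  carrier := {t | ∃ V : T.Opens, IsAffineOpen V ∧ t ∈ V ∧ ∃ c, HasCoefficients π p b V c}
  is_open' := by
    refine isOpen_iff_forall_mem_open.mpr fun t ⟨V, hV, ht, hc⟩ ↦ ?_
    exact ⟨V, fun s hs ↦ ⟨V, hV, hs, hc⟩, V.2, ht⟩

lemma mem_locus {t : T} : t ∈ locus π p b ↔ ∃ V : T.Opens, IsAffineOpen V ∧ t ∈ V ∧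
    ∃ c, HasCoefficients π p b V c := Iff.rfl

/-- The image under `π` of the complement of `p ⁻¹ᵁ U` is closed, because `π` is finite, and misses
`t`. So it can be avoided by shrinking a neighbourhood over which `π` is free. -/
lemma IsFiniteFlatOfRank.exists_isBasisVia (hπ : IsFiniteFlatOfRank π d) {t : T}
    (hU : ∀ z, π z = t → p z ∈ U) : ∃ V : T.Opens, IsAffineOpen V ∧ t ∈ V ∧
      π ⁻¹ᵁ V ≤ p ⁻¹ᵁ U ∧ ∃ e : Fin d → Γ(Z, π ⁻¹ᵁ V), IsBasisVia (π.app V).hom e := by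
  obtain ⟨hfin, hfr⟩ := hπ
  obtain ⟨V₀, hV₀, ht, hV₀'⟩ := hfr t
  obtain ⟨e, he⟩ := hV₀'.exists_isBasisVia
  have hcl : IsClosed (π '' ((p ⁻¹ᵁ U : Z.Opens) : Set Z)ᶜ) :=
    π.isClosedMap _ (p ⁻¹ᵁ U).2.isClosed_compl
  let W : T.Opens := ⟨_, hcl.isOpen_compl⟩
  have htW : t ∈ V₀ ⊓ W := ⟨ht, by
    rintro ⟨z, hz, hzt⟩
    exact hz (hU z hzt)⟩
  obtain ⟨V, hV, htV, hVW⟩ := exists_isAffineOpen_mem_and_subset htW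
  have hVV₀ : V ≤ (𝟙 T) ⁻¹ᵁ V₀ := fun _ hx ↦ (hVW hx).1
  have hp : IsPullback (𝟙 Z) π π (𝟙 T) := IsPullback.of_horiz_isIso ⟨by simp⟩
  refine ⟨V, hV, htV, fun z hz ↦ ?_, _,
    he.of_isPushout (isPushout_app_of_isPullback hp hV₀ hV hVV₀ (preimage_le_of_isPullback hp hVV₀))⟩
  by_contra hzU
  exact (hVW hz).2 ⟨z, hzU, rfl⟩

lemma isBasisVia_iff_isUnit_det {Z' T' : Scheme.{u}} {g' : Z' ⟶ Z} {π' : Z' ⟶ T'}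
    {g : T' ⟶ T} (hp : IsPullback g' π' π g) [IsAffineHom π] {V' : T'.Opens} (hV : IsAffineOpen V)
    (hV' : IsAffineOpen V') (hVV' : V' ≤ g ⁻¹ᵁ V) (le : π ⁻¹ᵁ V ≤ p ⁻¹ᵁ U)
    (le' : π' ⁻¹ᵁ V' ≤ (g' ≫ p) ⁻¹ᵁ U) {e : Fin d → Γ(Z, π ⁻¹ᵁ V)}
    (he : IsBasisVia (π.app V).hom e) {M : Matrix (Fin d) (Fin d) Γ(T, V)}
    (hM : ∀ j, (p.appLE U _ le).hom (b j) = ∑ i, (π.app V).hom (M i j) * e i) :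
    IsBasisVia (π'.app V').hom (((g' ≫ p).appLE U _ le').hom ∘ b) ↔
      IsUnit ((g.appLE V V' hVV').hom M.det) := by
  have hle := preimage_le_of_isPullback hp hVV'
  have hpo := isPushout_app_of_isPullback hp hV hV' hVV' hle
  have key (x : Γ(X, U)) : ((g' ≫ p).appLE U (π' ⁻¹ᵁ V') le').hom x =
      (g'.appLE (π ⁻¹ᵁ V) (π' ⁻¹ᵁ V') hle).hom ((p.appLE U (π ⁻¹ᵁ V) le).hom x) :=
    comp_appLE_apply g' p le hle le' x
  have hw (y : Γ(T, V)) : (g'.appLE (π ⁻¹ᵁ V) (π' ⁻¹ᵁ V') hle).hom ((π.app V).hom y) =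
      (π'.app V').hom ((g.appLE V V' hVV').hom y) := congrArg (fun k ↦ k.hom y) hpo.w
  rw [RingHom.map_det]
  refine IsBasisVia.iff_isUnit_det (he.of_isPushout hpo) fun j ↦ ?_
  rw [Function.comp_apply, key, hM, map_sum]
  simp only [map_mul, hw]
  rfl

lemma mem_locus_of_mem_basicOpen [IsAffineHom π] (hV : IsAffineOpen V) (le : π ⁻¹ᵁ V ≤ p ⁻¹ᵁ U)
    {e : Fin d → Γ(Z, π ⁻¹ᵁ V)}
    (he : IsBasisVia (π.app V).hom e) {M : Matrix (Fin d) (Fin d) Γ(T, V)}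
    (hM : ∀ j, (p.appLE U _ le).hom (b j) = ∑ i, (π.app V).hom (M i j) * e i) {t : T}
    (ht : t ∈ T.basicOpen M.det) : t ∈ locus π p b := by
  -- Restriction to a smaller open is treated as base change along the identity.
  have hp : IsPullback (𝟙 Z) π π (𝟙 T) := IsPullback.of_horiz_isIso ⟨by simp⟩
  have hle : T.basicOpen M.det ≤ (𝟙 T) ⁻¹ᵁ V := T.basicOpen_le _
  have hle' : π ⁻¹ᵁ T.basicOpen M.det ≤ (𝟙 Z ≫ p) ⁻¹ᵁ U :=
    (π.preimage_mono (T.basicOpen_le _)).trans (by simpa using le)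
  refine mem_locus.mpr ⟨_, hV.basicOpen M.det, ht, ?_⟩
  have h := HasCoefficients.exists_of_isBasisVia (π := π) (p := 𝟙 Z ≫ p) (b := b) hle'
    ((isBasisVia_iff_isUnit_det hp hV (hV.basicOpen M.det) hle le hle' he hM).mpr ?_)
  · simpa using h
  · have : (𝟙 T : T ⟶ T).appLE V (T.basicOpen M.det) hle = T.presheaf.map (homOfLE hle).op := by
      exact Category.id_comp _
    rw [this]
    exact RingedSpace.isUnit_res_basicOpen _ _

/-- The substance is descent from `T'` to `T`. Points of `Z` over `g t` lift to points of `Z'` over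
`t`, so they land in `U`, and a basis `e` exists near `g t`. The determinant comparing `b` with `e`
becomes a unit near `t`, so it is already invertible at `g t`. -/
lemma mem_locus_iff_of_isPullback {Z' T' : Scheme.{u}} {g' : Z' ⟶ Z} {π' : Z' ⟶ T'}
    {g : T' ⟶ T} (hp : IsPullback g' π' π g) (hπ : IsFiniteFlatOfRank π d) (t : T') :
    t ∈ locus π' (g' ≫ p) b ↔ g t ∈ locus π p b := by
  have := hπ.1
  constructor
  · rintro ⟨V₁, hV₁, ht₁, c, hc⟩
    obtain ⟨V, hV, htV, le, e, he⟩ := hπ.exists_isBasisVia (p := p) (U := U) (t := g t) (by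
      intro z hz
      obtain ⟨z', hz', hz''⟩ := exists_preimage_of_isPullback hp _ _ hz
      have := hc.le (show π' z' ∈ V₁ from hz'' ▸ ht₁)
      rw [← hz']
      simpa using this)
    obtain ⟨M, hM⟩ := he.exists_matrix fun j ↦ (p.appLE U _ le).hom (b j)
    refine mem_locus_of_mem_basicOpen hV le he hM ?_
    obtain ⟨V', hV', htV', hVV'⟩ := exists_isAffineOpen_mem_and_subset
      (show t ∈ V₁ ⊓ g ⁻¹ᵁ V from ⟨ht₁, htV⟩)
    have hle : V' ≤ g ⁻¹ᵁ V := fun _ hx ↦ (hVV' hx).2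
    have : IsAffineHom π' := MorphismProperty.of_isPullback (P := @IsAffineHom) hp inferInstance
    have hid : IsPullback (𝟙 Z') π' π' (𝟙 T') := IsPullback.of_horiz_isIso ⟨by simp⟩
    have hc' := hc.of_isPullback hid hV₁ hV' (V' := V') (fun _ hx ↦ (hVV' hx).1)
    rw [Category.id_comp] at hc'
    have hu := (isBasisVia_iff_isUnit_det hp hV hV' hle le hc'.le he hM).mp hc'.basis
    have : t ∈ T'.basicOpen ((g.appLE V V' hle).hom M.det) := by
      rwa [Scheme.basicOpen_of_isUnit _ hu]
    rw [Scheme.basicOpen_appLE] at this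
    exact this.2
  · rintro ⟨V, hV, ht, c, hc⟩
    obtain ⟨V', hV', ht', hle⟩ := exists_isAffineOpen_mem_and_subset (show t ∈ g ⁻¹ᵁ V from ht)
    exact ⟨V', hV', ht', _, hc.of_isPullback hp hV hV' hle⟩

end Charts

/-! ### The charts cover the Hilbert functor -/

section Subschemes

/-- A pushout of rings is a tensor product, hence additively generated by pure tensors. -/
lemma addSubgroup_eq_top_of_isPushout {A B A' B' : CommRingCat.{u}} {φ : A ⟶ B} {ψ : A ⟶ A'}
    {inl : B ⟶ B'} {inr : A' ⟶ B'} (h : IsPushout φ ψ inl inr) (J : AddSubgroup B')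
    (hJ : ∀ a x, inr.hom a * inl.hom x ∈ J) : J = ⊤ := by
  let := φ.hom.toAlgebra
  let := ψ.hom.toAlgebra
  let := inl.hom.toAlgebra
  let := inr.hom.toAlgebra
  let := (φ ≫ inl).hom.toAlgebra
  have : IsScalarTower A B B' := IsScalarTower.of_algebraMap_eq fun _ ↦ rfl
  have : IsScalarTower A A' B' := IsScalarTower.of_algebraMap_eq fun x ↦
    congr($(h.w).hom x)
  have hp : Algebra.IsPushout A A' B B' :=
    (CommRingCat.isPushout_iff_isPushout (R := A) (S := B) (R' := A') (S' := B')).mp h.flip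
  have key (x : B') : ∀ a : A', inr.hom a * x ∈ J := by
    refine hp.out.inductionOn x (fun x ↦ ∀ a : A', inr.hom a * x ∈ J) (fun a ↦ ?_)
      (fun m a ↦ hJ a m) (fun s n hn a ↦ ?_) (fun x y hx hy a ↦ ?_)
    · rw [mul_zero]
      exact J.zero_mem
    · have := hn (a * s)
      rwa [map_mul, mul_assoc] at this
    · rw [mul_add]
      exact J.add_mem (hx a) (hy a)
  refine top_le_iff.mp fun x _ ↦ ?_
  simpa using key x 1

variable {X S : Scheme.{u}} {f : X ⟶ S} {T : Over S} {U : X.Opens} {V : T.left.Opens}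

/-- This open is the fibre product of the affines `U` and `V` over the affine `S`. -/
lemma isAffineOpen_inf_preimage [IsAffine S] (hU : IsAffineOpen U) (hV : IsAffineOpen V) :
    IsAffineOpen (pullback.fst f T.hom ⁻¹ᵁ U ⊓ pullback.snd f T.hom ⁻¹ᵁ V) := by
  have h := Scheme.Hom.isPullback_resLE (IsPullback.of_hasPullback f T.hom) (US := ⊤) (UT := V)
    (UX := U) le_top le_top rfl
  have : IsAffine (⊤ : S.Opens) := isAffineOpen_top S
  have : IsAffine U := hU
  have : IsAffine V := hV
  exact .of_isIso h.isoPullback.hom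

lemma addSubgroup_eq_top [IsAffine S] (hU : IsAffineOpen U) (hV : IsAffineOpen V)
    (J : AddSubgroup Γ(pullback f T.hom, pullback.fst f T.hom ⁻¹ᵁ U ⊓ pullback.snd f T.hom ⁻¹ᵁ V))
    (hJ : ∀ a x, ((pullback.snd f T.hom).appLE V
      (pullback.fst f T.hom ⁻¹ᵁ U ⊓ pullback.snd f T.hom ⁻¹ᵁ V) inf_le_right).hom a *
      ((pullback.fst f T.hom).appLE U
      (pullback.fst f T.hom ⁻¹ᵁ U ⊓ pullback.snd f T.hom ⁻¹ᵁ V) inf_le_left).hom x ∈ J) : J = ⊤ := by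
  have h := IsPullback.of_hasPullback f T.hom
  have hp := (isIso_pushoutSection_iff h (US := ⊤) (UT := V) (UX := U) le_top le_top rfl).mp
    (isIso_pushoutSection_of_isAffineOpen h le_top le_top rfl (isAffineOpen_top S) hV hU)
  exact addSubgroup_eq_top_of_isPushout hp J hJ

lemma surjective_appLE {Z P : Scheme.{u}} (j : Z ⟶ P) [IsClosedImmersion j] {W : P.Opens}
    (hW : IsAffineOpen W) {W' : Z.Opens} (h : W' = j ⁻¹ᵁ W) :
    Function.Surjective (j.appLE W W' h.le).hom := by
  subst h
  rw [← Scheme.Hom.app_eq_appLE]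
  exact j.app_surjective W hW

/-- The fibre over `t` is finite, so its image lies in an affine `U`. Since `j` is a closed
immersion, functions on `U ×_S V` surject onto functions on `Z` over `V`; hence the functions on `U`
span these over `Γ(T.left, V)`, and `IsBasisVia.exists_det_notMem` selects `d` of them. -/
lemma exists_mem_locus [IsAffine S] (hX : IsAFScheme X) {d : ℕ} {Z : Scheme.{u}}
    (j : Z ⟶ pullback f T.hom) [IsClosedImmersion j]
    (hπ : IsFiniteFlatOfRank (j ≫ pullback.snd f T.hom) d) (t : T.left) :
    ∃ (U : X.affineOpens) (b : Fin d → Γ(X, U.1)),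
      t ∈ locus (j ≫ pullback.snd f T.hom) (j ≫ pullback.fst f T.hom) b := by
  generalize hπ' : j ≫ pullback.snd f T.hom = π at hπ ⊢
  generalize hp' : j ≫ pullback.fst f T.hom = p
  have := hπ.1
  obtain ⟨U, hU, hpU⟩ := hX (p '' (π ⁻¹' {t})) ((π.finite_preimage_singleton t).image _)
  obtain ⟨V, hV, htV, le, e, he⟩ := hπ.exists_isBasisVia (p := p) (U := U) (t := t)
    fun z hz ↦ hpU ⟨z, hz, rfl⟩
  have hle : π ⁻¹ᵁ V = j ⁻¹ᵁ (pullback.fst f T.hom ⁻¹ᵁ U ⊓ pullback.snd f T.hom ⁻¹ᵁ V) := by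
    rw [Scheme.Hom.preimage_inf, ← Scheme.Hom.comp_preimage, ← Scheme.Hom.comp_preimage, hπ', hp']
    exact (inf_eq_right.mpr le).symm
  have hsurj := surjective_appLE j (isAffineOpen_inf_preimage (f := f) hU hV) hle
  let ψ := (j.appLE _ _ hle.le).hom
  have h₁ (x : Γ(X, U)) : ψ (((pullback.fst f T.hom).appLE U _ inf_le_left).hom x) =
      (p.appLE U (π ⁻¹ᵁ V) le).hom x := by
    subst hp'
    exact (comp_appLE_apply _ _ _ _ _ x).symm
  have h₂ (x : Γ(T.left, V)) : ψ (((pullback.snd f T.hom).appLE V _ inf_le_right).hom x) =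
      (π.app V).hom x := by
    subst hπ'
    rw [Scheme.Hom.app_eq_appLE]
    exact (comp_appLE_apply _ _ _ _ _ x).symm
  -- The prime of `t` in `V`: a function lies outside `P` exactly when `t` is in its basic open.
  let P : Ideal Γ(T.left, V) := (IsLocalRing.maximalIdeal (T.left.presheaf.stalk t)).comap
    (T.left.presheaf.germ V t htV).hom
  obtain ⟨b, M, hM, hMP⟩ := he.exists_det_notMem ((p.appLE U (π ⁻¹ᵁ V) le).hom) (fun J hJ ↦ by
    have : J.comap ψ.toAddMonoidHom = ⊤ := addSubgroup_eq_top hU hV _ fun a x ↦ by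
      change ψ (_ * _) ∈ J
      rw [map_mul]
      have := hJ a x
      rw [← h₁, ← h₂] at this
      exact this
    refine top_le_iff.mp fun y _ ↦ ?_
    obtain ⟨x, rfl⟩ := hsurj y
    have hx : x ∈ J.comap ψ.toAddMonoidHom := this ▸ AddSubgroup.mem_top x
    exact hx) P
  refine ⟨⟨U, hU⟩, b, mem_locus_of_mem_basicOpen hV le he hM ?_⟩
  rw [Scheme.mem_basicOpen _ _ _ htV]
  by_contra h
  exact hMP h

end Subschemes

/-! ### A closed subscheme is determined by its coefficient table -/

section Determination

variable {X S : Scheme.{u}} {f : X ⟶ S} {T : Over S}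

/-- Functions on `U ×_S V` are sums of products of some `a` from `V` and `x` from `U`. Such a
product has coefficients `a * c x i` on both `Z` and `Z'`, so one vector `v` serves for both. -/
lemma exists_coefficients [IsAffine S] {d : ℕ} {U : X.Opens} {V : T.left.Opens}
    (hU : IsAffineOpen U) (hV : IsAffineOpen V) {Z Z' : Scheme.{u}}
    (j : Z ⟶ pullback f T.hom) (j' : Z' ⟶ pullback f T.hom) {b : Fin d → Γ(X, U)}
    {c : Γ(X, U) → Fin d → Γ(T.left, V)}
    {W : (pullback f T.hom).Opens}
    (hW : W = pullback.fst f T.hom ⁻¹ᵁ U ⊓ pullback.snd f T.hom ⁻¹ᵁ V)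
    (h : HasCoefficients (j ≫ pullback.snd f T.hom) (j ≫ pullback.fst f T.hom) b V c)
    (h' : HasCoefficients (j' ≫ pullback.snd f T.hom) (j' ≫ pullback.fst f T.hom) b V c)
    (hj : (j ≫ pullback.snd f T.hom) ⁻¹ᵁ V ≤ j ⁻¹ᵁ W)
    (hj' : (j' ≫ pullback.snd f T.hom) ⁻¹ᵁ V ≤ j' ⁻¹ᵁ W)
    (y : Γ(pullback f T.hom, W)) :
    ∃ v : Fin d → Γ(T.left, V),
      (j.appLE W _ hj).hom y = ∑ i, ((j ≫ pullback.snd f T.hom).app V).hom (v i) *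
        ((j ≫ pullback.fst f T.hom).appLE U _ h.le).hom (b i) ∧
      (j'.appLE W _ hj').hom y = ∑ i, ((j' ≫ pullback.snd f T.hom).app V).hom (v i) *
        ((j' ≫ pullback.fst f T.hom).appLE U _ h'.le).hom (b i) := by
  subst hW
  let J : AddSubgroup Γ(pullback f T.hom,
      pullback.fst f T.hom ⁻¹ᵁ U ⊓ pullback.snd f T.hom ⁻¹ᵁ V) :=
    { carrier := {y | ∃ v : Fin d → Γ(T.left, V),
        (j.appLE _ _ hj).hom y = ∑ i, ((j ≫ pullback.snd f T.hom).app V).hom (v i) *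
          ((j ≫ pullback.fst f T.hom).appLE U _ h.le).hom (b i) ∧
        (j'.appLE _ _ hj').hom y = ∑ i, ((j' ≫ pullback.snd f T.hom).app V).hom (v i) *
          ((j' ≫ pullback.fst f T.hom).appLE U _ h'.le).hom (b i)}
      add_mem' := by
        rintro x y ⟨v, hv, hv'⟩ ⟨w, hw, hw'⟩
        exact ⟨v + w, by simp only [map_add, hv, hw, Pi.add_apply, add_mul,
          Finset.sum_add_distrib], by simp only [map_add, hv', hw', Pi.add_apply, add_mul,
          Finset.sum_add_distrib]⟩
      zero_mem' := ⟨0, by simp only [map_zero, Pi.zero_apply, zero_mul, Finset.sum_const_zero],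
        by simp only [map_zero, Pi.zero_apply, zero_mul, Finset.sum_const_zero]⟩
      neg_mem' := by
        rintro x ⟨v, hv, hv'⟩
        exact ⟨-v, by simp only [map_neg, hv, Pi.neg_apply, neg_mul, Finset.sum_neg_distrib],
          by simp only [map_neg, hv', Pi.neg_apply, neg_mul, Finset.sum_neg_distrib]⟩ }
  have key {Z : Scheme.{u}} (j : Z ⟶ pullback f T.hom)
      (h : HasCoefficients (j ≫ pullback.snd f T.hom) (j ≫ pullback.fst f T.hom) b V c)
      (hj : (j ≫ pullback.snd f T.hom) ⁻¹ᵁ V ≤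
        j ⁻¹ᵁ (pullback.fst f T.hom ⁻¹ᵁ U ⊓ pullback.snd f T.hom ⁻¹ᵁ V))
      (a : Γ(T.left, V)) (x : Γ(X, U)) :
      (j.appLE _ _ hj).hom (((pullback.snd f T.hom).appLE V
        (pullback.fst f T.hom ⁻¹ᵁ U ⊓ pullback.snd f T.hom ⁻¹ᵁ V) inf_le_right).hom a *
        ((pullback.fst f T.hom).appLE U
        (pullback.fst f T.hom ⁻¹ᵁ U ⊓ pullback.snd f T.hom ⁻¹ᵁ V) inf_le_left).hom x) =
      ∑ i, ((j ≫ pullback.snd f T.hom).app V).hom (a * c x i) *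
          ((j ≫ pullback.fst f T.hom).appLE U _ h.le).hom (b i) := by
    have e₁ := comp_appLE_apply j (pullback.fst f T.hom) inf_le_left hj h.le x
    have e₂ := comp_appLE_apply j (pullback.snd f T.hom) inf_le_right hj le_rfl a
    rw [← Scheme.Hom.app_eq_appLE] at e₂
    rw [map_mul, ← e₁, ← e₂, h.eq x, Finset.mul_sum]
    simp only [map_mul, mul_assoc]
  have hJ : J = ⊤ := addSubgroup_eq_top hU hV J fun a x ↦
    ⟨fun i ↦ a * c x i, key j h hj a x, key j' h' hj' a x⟩
  have hy : y ∈ J := hJ ▸ AddSubgroup.mem_top y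
  exact hy

lemma ker_comp_eq_of_ker_eq {Z Z' P Q : Scheme.{u}} {l : Z ⟶ Q} {l' : Z' ⟶ Q}
    (h : l.ker = l'.ker) (i : Q ⟶ P) : (l ≫ i).ker = (l' ≫ i).ker := by
  rw [← Scheme.IdealSheafData.map_bot, ← Scheme.IdealSheafData.map_bot,
    Scheme.IdealSheafData.map_comp, Scheme.IdealSheafData.map_comp,
    Scheme.IdealSheafData.map_bot, Scheme.IdealSheafData.map_bot, h]

/-- Over an affine base, a closed subscheme is determined by the multiplication table of a basis of
functions. -/
lemma ker_eq_of_hasCoefficients [IsAffine S] [IsAffine T.left] {d : ℕ} {U : X.Opens}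
    (hU : IsAffineOpen U) {Z Z' : Scheme.{u}}
    (j : Z ⟶ pullback f T.hom) (j' : Z' ⟶ pullback f T.hom) {b : Fin d → Γ(X, U)}
    {c : Γ(X, U) → Fin d → Γ(T.left, ⊤)}
    (h : HasCoefficients (j ≫ pullback.snd f T.hom) (j ≫ pullback.fst f T.hom) b ⊤ c)
    (h' : HasCoefficients (j' ≫ pullback.snd f T.hom) (j' ≫ pullback.fst f T.hom) b ⊤ c) :
    j.ker = j'.ker := by
  let W : (pullback f T.hom).Opens := pullback.fst f T.hom ⁻¹ᵁ U ⊓ pullback.snd f T.hom ⁻¹ᵁ ⊤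
  have hWa : IsAffine W := isAffineOpen_inf_preimage hU (isAffineOpen_top T.left)
  have hle {Z : Scheme.{u}} {j : Z ⟶ pullback f T.hom}
      (h : HasCoefficients (j ≫ pullback.snd f T.hom) (j ≫ pullback.fst f T.hom) b ⊤ c) :
      ⊤ ≤ j ⁻¹ᵁ W := fun z _ ↦ ⟨h.le (show z ∈ _ from trivial), trivial⟩
  have hr {Z : Scheme.{u}} {j : Z ⟶ pullback f T.hom}
      (h : HasCoefficients (j ≫ pullback.snd f T.hom) (j ≫ pullback.fst f T.hom) b ⊤ c) :
      Set.range j ⊆ Set.range W.ι := by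
    rintro _ ⟨z, rfl⟩
    rw [Scheme.Opens.range_ι]
    exact hle h (show z ∈ _ from trivial)
  -- Both maps factor through the affine open `W`, so it is enough to compare kernels on global
  -- sections of `W`.
  let l := IsOpenImmersion.lift W.ι j (hr h)
  let l' := IsOpenImmersion.lift W.ι j' (hr h')
  have hl : l ≫ W.ι = j := IsOpenImmersion.lift_fac _ _ _
  have hl' : l' ≫ W.ι = j' := IsOpenImmersion.lift_fac _ _ _
  rw [← hl, ← hl']
  refine ker_comp_eq_of_ker_eq ?_ _
  rw [Scheme.ker_of_isAffine, Scheme.ker_of_isAffine]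
  congr 1
  have hι : (⊤ : Scheme.Opens W) = W.ι ⁻¹ᵁ W := by simp
  ext y
  obtain ⟨y, rfl⟩ := (bijective_appLE W.ι hι (by simp)).2 y
  have hly {Z : Scheme.{u}} {l : Z ⟶ W} {j : Z ⟶ pullback f T.hom} (hl : l ≫ W.ι = j)
      (hj : ⊤ ≤ j ⁻¹ᵁ W) : l.appTop.hom ((W.ι.appLE W ⊤ hι.le).hom y) =
        (j.appLE W ⊤ hj).hom y := by
    subst hl
    rw [Scheme.Hom.appTop, Scheme.Hom.app_eq_appLE]
    exact (comp_appLE_apply _ _ _ _ _ y).symm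
  rw [RingHom.mem_ker, RingHom.mem_ker, hly hl (hle h), hly hl' (hle h')]
  -- By independence of the bases, `y` vanishes on `Z`, respectively on `Z'`, exactly when the
  -- common vector `v` is zero.
  obtain ⟨v, hv, hv'⟩ := exists_coefficients hU (isAffineOpen_top T.left) j j' rfl h h'
    (hle h) (hle h') y
  have hz {Z : Scheme.{u}} {j : Z ⟶ pullback f T.hom}
      (h : HasCoefficients (j ≫ pullback.snd f T.hom) (j ≫ pullback.fst f T.hom) b ⊤ c) :
      ∑ i, ((j ≫ pullback.snd f T.hom).app ⊤).hom (v i) *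
        ((j ≫ pullback.fst f T.hom).appLE U _ h.le).hom (b i) = 0 ↔ v = 0 := by
    have h₀ : ∑ i, ((j ≫ pullback.snd f T.hom).app ⊤).hom ((0 : Fin d → Γ(T.left, ⊤)) i) *
        ((j ≫ pullback.fst f T.hom).appLE U _ h.le).hom (b i) = 0 := by
      simp only [map_zero, Pi.zero_apply, zero_mul, Finset.sum_const_zero]
    refine ⟨fun hv ↦ h.basis.1 (hv.trans h₀.symm), ?_⟩
    rintro rfl
    exact h₀
  exact (Eq.congr_left hv).trans ((hz h).trans ((hz h').symm.trans (Eq.congr_left hv').symm))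

end Determination

/-- Two points of `X` always lie in a common affine `U`, so the opens `U ×_S U` cover `X ×_S X`.
Over each of them the diagonal is a section, up to isomorphism, of a projection between affine
schemes, hence a closed immersion. -/
lemma IsAFScheme.isSeparated {X S : Scheme.{u}} [IsAffine S] (hX : IsAFScheme X) (f : X ⟶ S) :
    IsSeparated f := by
  constructor
  let W (U : X.affineOpens) : (pullback f f).Opens :=
    pullback.fst f f ⁻¹ᵁ U.1 ⊓ pullback.snd f f ⁻¹ᵁ U.1
  refine IsZariskiLocalAtTarget.of_iSup_eq_top (P := @IsClosedImmersion) W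
    (top_le_iff.mp fun z _ ↦ ?_) fun U ↦ ?_
  · obtain ⟨U, hU, hz⟩ := hX {pullback.fst f f z, pullback.snd f f z} (Set.toFinite _)
    exact TopologicalSpace.Opens.mem_iSup.mpr ⟨⟨U, hU⟩, hz (by simp), hz (by simp)⟩
  · have : IsAffine (W U) := isAffineOpen_inf_preimage (f := f) (T := Over.mk f) U.2 U.2
    have : IsAffine U.1 := U.2
    have hδ : pullback.diagonal f ⁻¹ᵁ W U = U.1 := by
      simp only [W, Scheme.Hom.preimage_inf, ← Scheme.Hom.comp_preimage, pullback.diagonal_fst,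
        pullback.diagonal_snd]
      exact inf_idem _
    have h : (pullback.diagonal f ∣_ W U) ≫ (pullback.fst f f).resLE U.1 (W U) inf_le_left =
        (X.isoOfEq hδ).hom := by
      rw [← cancel_mono U.1.ι]
      simp
    have : IsClosedImmersion
        ((pullback.diagonal f ∣_ W U) ≫ (pullback.fst f f).resLE U.1 (W U) inf_le_left) := by
      rw [h]
      infer_instance
    exact .of_comp _ ((pullback.fst f f).resLE U.1 (W U) inf_le_left)

/-! ### The affine scheme of coefficient tables and its universal family -/

section UniversalFamily

lemma fromSpec_appLE_top {X : Scheme.{u}} {U : X.Opens} (hU : IsAffineOpen U)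
    (h : ⊤ ≤ hU.fromSpec ⁻¹ᵁ U) : hU.fromSpec.appLE U ⊤ h = (Scheme.ΓSpecIso Γ(X, U)).inv := by
  rw [Scheme.Hom.appLE, hU.fromSpec_app_self, Category.assoc, ← Functor.map_comp]
  exact (congrArg _ (CategoryTheory.Functor.map_id _ _)).trans (Category.comp_id _)

lemma appLE_top_top {X Y : Scheme.{u}} (f : X ⟶ Y) (h : ⊤ ≤ f ⁻¹ᵁ ⊤) :
    f.appLE ⊤ ⊤ h = f.appTop :=
  f.app_eq_appLE.symm

lemma appLE_top_top_apply {X Y : Scheme.{u}} (f : X ⟶ Y) (h : ⊤ ≤ f ⁻¹ᵁ ⊤) (x : Γ(Y, ⊤)) :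
    (f.appLE ⊤ ⊤ h).hom x = f.appTop.hom x :=
  congrArg (fun k ↦ k.hom x) (appLE_top_top f h)

variable {X : Scheme.{u}} {U : X.Opens} {d : ℕ} {b : Fin d → Γ(X, U)}

lemma hasCoefficients_Spec (hU : IsAffineOpen U) {C Q : CommRingCat.{u}} (κ : C ⟶ Q)
    (χ : Γ(X, U) ⟶ Q) {c : Γ(X, U) → Fin d → C} (hb : IsBasisVia κ.hom (χ.hom ∘ b))
    (hc : ∀ x, χ.hom x = ∑ i, κ.hom (c x i) * χ.hom (b i)) :
    HasCoefficients (Spec.map κ) (Spec.map χ ≫ hU.fromSpec) b ⊤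
      fun x i ↦ (Scheme.ΓSpecIso C).inv.hom (c x i) := by
  have hU' : ⊤ ≤ hU.fromSpec ⁻¹ᵁ U := hU.fromSpec_preimage_self.ge
  have le : ⊤ ≤ (Spec.map χ ≫ hU.fromSpec) ⁻¹ᵁ U := fun x _ ↦
    hU' (show Spec.map χ x ∈ (⊤ : (Spec Γ(X, U)).Opens) from trivial)
  have key (x : Γ(X, U)) : ((Spec.map χ ≫ hU.fromSpec).appLE U ⊤ le).hom x =
      (Scheme.ΓSpecIso Q).inv.hom (χ.hom x) := by
    rw [comp_appLE_apply _ _ hU' le_top, fromSpec_appLE_top]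
    exact (appLE_top_top_apply _ _ _).trans
      (congrArg (fun k ↦ k.hom x) (Scheme.ΓSpecIso_inv_naturality χ).symm)
  have hκ (x : C) : ((Spec.map κ).app ⊤).hom ((Scheme.ΓSpecIso C).inv.hom x) =
      (Scheme.ΓSpecIso Q).inv.hom (κ.hom x) :=
    congrArg (fun k ↦ k.hom x) (Scheme.ΓSpecIso_inv_naturality κ).symm
  have hpo : IsPushout κ (Scheme.ΓSpecIso C).inv (Scheme.ΓSpecIso Q).inv ((Spec.map κ).app ⊤) :=
    IsPushout.of_vert_isIso ⟨Scheme.ΓSpecIso_inv_naturality κ⟩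
  refine ⟨le, ?_, fun x ↦ ?_⟩
  · have := hb.of_isPushout hpo
    exact (congrArg (IsBasisVia _) (funext fun i ↦ (key (b i)).symm)).mp this
  · refine (key x).trans ?_
    rw [hc, map_sum]
    refine Finset.sum_congr rfl fun i _ ↦ ?_
    rw [map_mul, ← hκ, ← key]
    rfl

lemma isFiniteFlatOfRank_SpecMap {C Q : CommRingCat.{u}} (κ : C ⟶ Q) {v : Fin d → Q}
    (hv : IsBasisVia κ.hom v) : IsFiniteFlatOfRank (Spec.map κ) d := by
  refine ⟨(IsFinite.SpecMap_iff κ).mpr ?_, fun _ ↦ ⟨⊤, isAffineOpen_top _, trivial, ?_⟩⟩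
  · let := κ.hom.toAlgebra
    obtain ⟨e, -⟩ := IsBasisVia.exists_basis (A := C) (B := Q) hv
    exact Module.Finite.of_basis e
  · have hpo : IsPushout κ (Scheme.ΓSpecIso C).inv (Scheme.ΓSpecIso Q).inv ((Spec.map κ).app ⊤) :=
      IsPushout.of_vert_isIso ⟨Scheme.ΓSpecIso_inv_naturality κ⟩
    exact (hv.of_isPushout hpo).freeOfRank

/-- The ring `Q` is generated by the images of `κ` and `χ`, and a map to `Spec Q` is determined on
these by its two projections. -/
lemma mono_lift_of_isBasisVia {S : Scheme.{u}} {f : X ⟶ S} (hU : IsAffineOpen U)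
    {C Q : CommRingCat.{u}} (κ : C ⟶ Q) (χ : Γ(X, U) ⟶ Q) (hb : IsBasisVia κ.hom (χ.hom ∘ b))
    {g : Spec C ⟶ S} (w : (Spec.map χ ≫ hU.fromSpec) ≫ f = Spec.map κ ≫ g) :
    Mono (pullback.lift _ _ w) := by
  constructor
  intro Y r s hrs
  have h₁ : r ≫ Spec.map χ = s ≫ Spec.map χ := by
    rw [← cancel_mono hU.fromSpec]
    have := congr($hrs ≫ pullback.fst _ _)
    rwa [Category.assoc, Category.assoc, pullback.lift_fst, ← Category.assoc, ← Category.assoc] at this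
  have h₂ : r ≫ Spec.map κ = s ≫ Spec.map κ := by
    have := congr($hrs ≫ pullback.snd _ _)
    rwa [Category.assoc, Category.assoc, pullback.lift_snd] at this
  have key {D : CommRingCat.{u}} (ψ : D ⟶ Q) (h : r ≫ Spec.map ψ = s ≫ Spec.map ψ) (x : D) :
      r.appTop.hom ((Scheme.ΓSpecIso Q).inv.hom (ψ.hom x)) =
        s.appTop.hom ((Scheme.ΓSpecIso Q).inv.hom (ψ.hom x)) := by
    have e : (ψ ≫ (Scheme.ΓSpecIso Q).inv) ≫ r.appTop = (ψ ≫ (Scheme.ΓSpecIso Q).inv) ≫ s.appTop := by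
      rw [Scheme.ΓSpecIso_inv_naturality, Category.assoc, Category.assoc, ← Scheme.Hom.comp_appTop,
        ← Scheme.Hom.comp_appTop, h]
    exact congrArg (fun k ↦ k.hom x) e
  refine ext_of_isAffine ?_
  rw [← cancel_epi (Scheme.ΓSpecIso Q).inv]
  ext y
  obtain ⟨a, rfl⟩ := hb.2 y
  change r.appTop.hom ((Scheme.ΓSpecIso Q).inv.hom _) = s.appTop.hom ((Scheme.ΓSpecIso Q).inv.hom _)
  simp only [map_sum, map_mul, Function.comp_apply]
  exact Finset.sum_congr rfl fun i _ ↦ congrArg₂ _ (key κ h₂ _) (key χ h₁ _)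

/-- The functor of multiplication tables of `b` is represented by an affine scheme carrying a
universal family. -/
lemma exists_universalFamily {S : Scheme.{u}} [IsAffine S] (f : X ⟶ S) [IsSeparated f]
    (hU : IsAffineOpen U) (b : Fin d → Γ(X, U)) :
    ∃ (H : Over S) (ξ : (hilbertFunctor f d).obj (.op H)) (c₀ : Γ(X, U) → Fin d → Γ(H.left, ⊤)),
      IsAffine H.left ∧ HasCoefficients (ξ.1.subschemeι ≫ pullback.snd f H.hom)
        (ξ.1.subschemeι ≫ pullback.fst f H.hom) b ⊤ c₀ ∧
      ∀ (T : Over S) (c : Γ(X, U) → Fin d → Γ(T.left, ⊤)),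
        IsCoefficients (f.appLE ⊤ U le_top).hom T.hom.appTop.hom b c →
        ∃! a : T ⟶ H, ∀ x i, a.left.appTop.hom (c₀ x i) = c x i := by
  let := (f.appLE ⊤ U le_top).hom.toAlgebra
  let A := Γ(S, ⊤)
  let C : CommRingCat.{u} := .of (CoefficientRing A Γ(X, U) b)
  obtain ⟨Q, _, κ, χ, hκχ, hb, hc⟩ :=
    (isCoefficients_universalCoefficient A Γ(X, U) b).exists_algebra
  let α : Γ(S, ⊤) ⟶ C := CommRingCat.ofHom (algebraMap A C)
  let H : Over S := Over.mk (Spec.map α ≫ S.isoSpec.inv)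
  let κ' : C ⟶ .of Q := CommRingCat.ofHom κ
  let χ' : Γ(X, U) ⟶ .of Q := CommRingCat.ofHom χ
  have hw : f.appLE ⊤ U le_top ≫ χ' = α ≫ κ' := by
    ext x
    exact congr($hκχ x)
  have w : (Spec.map χ' ≫ hU.fromSpec) ≫ f = Spec.map κ' ≫ H.hom := by
    have e := (isAffineOpen_top S).SpecMap_appLE_fromSpec f hU (le_top : U ≤ f ⁻¹ᵁ ⊤)
    rw [IsAffineOpen.fromSpec_top] at e
    rw [Category.assoc, ← e, ← Spec.map_comp_assoc, hw, Spec.map_comp_assoc]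
    rfl
  let j := pullback.lift _ _ w
  have hj₁ : j ≫ pullback.fst f H.hom = Spec.map χ' ≫ hU.fromSpec := pullback.lift_fst _ _ w
  have hj₂ : j ≫ pullback.snd f H.hom = Spec.map κ' := pullback.lift_snd _ _ w
  have hflat : IsFiniteFlatOfRank (Spec.map κ') d := isFiniteFlatOfRank_SpecMap κ' hb
  have hcoef := hasCoefficients_Spec hU κ' χ' (b := b) hb hc
  rw [← hj₂] at hflat
  rw [← hj₁, ← hj₂] at hcoef
  have : Mono j := mono_lift_of_isBasisVia hU κ' χ' hb w
  have : IsFinite (j ≫ pullback.snd f H.hom) := hflat.1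
  -- Separatedness of `f` enters here: `pullback.snd` is separated, so finiteness of the composite
  -- passes to `j`, and a finite monomorphism is a closed immersion.
  have : IsFinite j := .of_comp j (pullback.snd f H.hom)
  have : IsClosedImmersion j := (IsClosedImmersion.iff_isFinite_and_mono j).mpr ⟨‹_›, ‹_›⟩
  have hinv : inv j.toImage ≫ j = j.ker.subschemeι := by
    rw [IsIso.inv_comp_eq]
    exact j.toImage_imageι.symm
  -- The closed subscheme cut out by `j.ker` is isomorphic to `Spec Q`; the properties of the family
  -- are carried across this isomorphism as a base change along the identity.
  have hp : IsPullback (inv j.toImage) (j.ker.subschemeι ≫ pullback.snd f H.hom)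
      (j ≫ pullback.snd f H.hom) (𝟙 _) :=
    IsPullback.of_horiz_isIso ⟨by rw [← hinv]; simp⟩
  have : IsAffine H.left := inferInstanceAs (IsAffine (Spec C))
  have hcoef' := hcoef.of_isPullback hp (isAffineOpen_top _) (isAffineOpen_top _) (V' := ⊤) le_top
  rw [← Category.assoc, hinv] at hcoef'
  refine ⟨H, ⟨j.ker, hflat.of_isPullback hp⟩,
    fun x i ↦ (Scheme.ΓSpecIso C).inv.hom (universalCoefficient A Γ(X, U) b x i),
    this, ?_, ?_⟩
  · refine (congrArg (HasCoefficients _ _ b _) ?_).mp hcoef'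
    ext x i
    exact appLE_top_top_apply _ _ _
  intro T c hTc
  obtain ⟨g, hg, hg'⟩ := hTc.exists_lift
  have hinvTop : S.isoSpec.inv.appTop = (Scheme.ΓSpecIso Γ(S, ⊤)).inv := by
    rw [← Iso.hom_comp_eq_id, ← Scheme.toSpecΓ_appTop, ← Scheme.Hom.comp_appTop,
      Scheme.isoSpec_inv_toSpecΓ, Scheme.Hom.id_appTop]
  let g' : C ⟶ Γ(T.left, ⊤) := CommRingCat.ofHom g
  have hg₁ : α ≫ g' = T.hom.appTop := by
    ext x
    exact congr($hg x)
  let a₀ : T.left ⟶ Spec C := T.left.toSpecΓ ≫ Spec.map g'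
  have ha₀ : a₀ ≫ H.hom = T.hom := by
    change (T.left.toSpecΓ ≫ Spec.map g') ≫ Spec.map α ≫ S.isoSpec.inv = T.hom
    rw [Category.assoc, ← Spec.map_comp_assoc, hg₁, ← Scheme.toSpecΓ_naturality_assoc,
      Scheme.toSpecΓ_isoSpec_inv]
    exact Category.comp_id _
  have ha₀' : (Scheme.ΓSpecIso C).inv ≫ a₀.appTop = g' := by
    rw [Scheme.Hom.comp_appTop, Scheme.toSpecΓ_appTop, Scheme.ΓSpecIso_naturality,
      Iso.inv_hom_id_assoc]
  have huniv (a : T ⟶ H) (ha : ∀ x i, a.left.appTop.hom ((Scheme.ΓSpecIso C).inv.hom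
      (universalCoefficient A Γ(X, U) b x i)) = c x i) :
      (Scheme.ΓSpecIso C).inv ≫ a.left.appTop = g' := by
    refine CommRingCat.hom_ext (CoefficientRing.hom_ext ?_ fun x i ↦ (ha x i).trans (hg' x i).symm)
    have : α ≫ (Scheme.ΓSpecIso C).inv ≫ a.left.appTop = α ≫ g' := by
      rw [hg₁, ← Over.w a]
      change _ = (a.left ≫ Spec.map α ≫ S.isoSpec.inv).appTop
      rw [Scheme.Hom.comp_appTop, Scheme.Hom.comp_appTop, hinvTop,
        ← Scheme.ΓSpecIso_inv_naturality, Category.assoc]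
    exact congrArg CommRingCat.Hom.hom this
  refine ⟨Over.homMk a₀ ha₀, fun x i ↦ ?_, fun a ha ↦ Over.OverMorphism.ext ?_⟩
  · exact (congrArg (fun k ↦ k.hom (universalCoefficient A Γ(X, U) b x i)) ha₀').trans (hg' x i)
  · have := huniv a ha
    refine ext_of_isAffine (Y := Spec C) ?_
    rw [← cancel_epi (Scheme.ΓSpecIso C).inv]
    exact this.trans ha₀'.symm

end UniversalFamily

/-! ### The Hilbert charts and the conclusion -/

open Opposite

/-- Injectivity may be checked on an affine cover. It then makes the local morphisms to `H` supplied
by `hex` agree on overlaps, so they glue; uniqueness of gluing for `F` shows that the glued morphism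
pulls `ξ` back to the given section. -/
lemma IsOpenChart.of_isAffine {S : Scheme.{u}} {F : (Over S)ᵒᵖ ⥤ Type u} (hF : HasUniqueGluing F)
    {H : Over S} {ξ : F.obj (op H)} (E : ∀ T : Over S, F.obj (op T) → T.left.Opens)
    (hE : ∀ (T T' : Over S) (h : T' ⟶ T) (x : F.obj (op T)) (t : T'.left),
      t ∈ E T' (F.map h.op x) ↔ h.left t ∈ E T x)
    (hξ : ∀ t, t ∈ E H ξ)
    (hinj : ∀ (T : Over S) (_ : IsAffine T.left) (a c : T ⟶ H),
      F.map a.op ξ = F.map c.op ξ → a = c)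
    (hex : ∀ (T : Over S) (x : F.obj (op T)), ∀ t ∈ E T x, ∃ V : T.left.Opens, t ∈ V ∧
      ∃ a : Over.mk (V.ι ≫ T.hom) ⟶ H, F.map a.op ξ =
        F.map (Over.homMk V.ι : Over.mk (V.ι ≫ T.hom) ⟶ T).op x) :
    IsOpenChart F H ξ := by
  have inj {T : Over S} (a c : T ⟶ H) (h : F.map a.op ξ = F.map c.op ξ) : a = c := by
    refine Over.OverMorphism.ext (T.left.affineCover.hom_ext _ _ fun i ↦ ?_)
    let k : Over.mk (T.left.affineCover.f i ≫ T.hom) ⟶ T := Over.homMk (T.left.affineCover.f i)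
    have : k ≫ a = k ≫ c := hinj _ (inferInstanceAs (IsAffine (T.left.affineCover.X i))) _ _ (by
      rw [← map_map_apply, ← map_map_apply, h])
    exact congrArg Over.Hom.left this
  refine ⟨inj, fun T x ↦ ⟨E T x, fun T' h ↦ ⟨?_, fun hT' ↦ ?_⟩⟩⟩
  · rintro ⟨a, ha⟩ t
    rw [← hE, ← ha, hE]
    exact hξ _
  · generalize hx' : F.map h.op x = x'
    have hT'' (t : T'.left) : t ∈ E T' x' := by
      rw [← hx', hE]
      exact hT' t
    choose V hV a ha using fun t ↦ hex T' x' t (hT'' t)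
    let 𝒰 : T'.left.OpenCover := Scheme.Cover.mkOfCovers (P := @IsOpenImmersion) T'.left
      (fun t ↦ (V t).toScheme) (fun t ↦ (V t).ι) (fun t ↦ ⟨t, ⟨t, hV t⟩, rfl⟩) inferInstance
    let k (t) : Over.mk ((V t).ι ≫ T'.hom) ⟶ T' := Over.homMk (V t).ι
    have hcomp (s t : T'.left) : pullback.fst (𝒰.f s) (𝒰.f t) ≫ (a s).left =
        pullback.snd (𝒰.f s) (𝒰.f t) ≫ (a t).left := by
      let W : Over S := Over.mk (pullback.fst (𝒰.f s) (𝒰.f t) ≫ (V s).ι ≫ T'.hom)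
      let r : W ⟶ Over.mk ((V s).ι ≫ T'.hom) := Over.homMk (pullback.fst (𝒰.f s) (𝒰.f t))
      let r' : W ⟶ Over.mk ((V t).ι ≫ T'.hom) := Over.homMk (pullback.snd (𝒰.f s) (𝒰.f t))
        ((pullback.condition_assoc (f := 𝒰.f s) (g := 𝒰.f t) T'.hom).symm)
      have hr : r ≫ k s = r' ≫ k t :=
        Over.OverMorphism.ext (pullback.condition (f := 𝒰.f s) (g := 𝒰.f t))
      have := inj (r ≫ a s) (r' ≫ a t) (by
        rw [← map_map_apply, ← map_map_apply, ha, ha, map_map_apply, map_map_apply]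
        exact congrArg (fun q : W ⟶ T' ↦ F.map q.op x') hr)
      exact congrArg Over.Hom.left this
    let g : T'.left ⟶ H.left := 𝒰.glueMorphisms (fun t ↦ (a t).left) hcomp
    have hg (t) : (V t).ι ≫ g = (a t).left := 𝒰.ι_glueMorphisms _ _ t
    let g' : T' ⟶ H := Over.homMk g (𝒰.hom_ext _ _ fun t ↦ by
      change (V t).ι ≫ g ≫ H.hom = (V t).ι ≫ T'.hom
      exact (Category.assoc _ _ _).symm.trans ((congrArg (· ≫ H.hom) (hg t)).trans (Over.w (a t))))
    have hk (t) : k t ≫ g' = a t := Over.OverMorphism.ext (hg t)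
    refine ⟨g', ?_⟩
    refine (hF T' (ULift.{u + 1} T'.left) (fun t ↦ Over.mk ((V t.down).ι ≫ T'.hom))
      (fun t ↦ k t.down) (fun t ↦ inferInstanceAs (IsOpenImmersion (V t.down).ι))
      (fun t ↦ ⟨⟨t⟩, ⟨t, hV t⟩, rfl⟩) (fun t ↦ F.map (k t.down).op x')
      (fun s t W r r' hr ↦ ?_)).unique (fun t ↦ ?_) (fun t ↦ rfl)
    · rw [map_map_apply, map_map_apply, hr]
    · rw [map_map_apply, hk, ha]

section HilbertCharts

variable {X S : Scheme.{u}} {f : X ⟶ S} {d : ℕ} {U : X.Opens} {b : Fin d → Γ(X, U)}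

lemma isPullback_hilbertFunctor_map {T T' : Over S} (h : T' ⟶ T)
    (x : (hilbertFunctor f d).obj (op T)) :
    ∃ g', IsPullback g' (((hilbertFunctor f d).map h.op x).1.subschemeι ≫ pullback.snd f T'.hom)
      (x.1.subschemeι ≫ pullback.snd f T.hom) h.left ∧
      g' ≫ x.1.subschemeι ≫ pullback.fst f T.hom =
        ((hilbertFunctor f d).map h.op x).1.subschemeι ≫ pullback.fst f T'.hom := by
  obtain ⟨I, hI⟩ := x
  refine ⟨_, isPullback_subscheme_comap f h I, ?_⟩
  change ((I.comapIso (baseChangeMap f h)).hom ≫ pullback.snd _ _) ≫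
    I.subschemeι ≫ pullback.fst f T.hom =
      (I.comap (baseChangeMap f h)).subschemeι ≫ pullback.fst f T'.hom
  rw [← baseChangeMap_fst f h, Category.assoc, ← pullback.condition_assoc,
    ← Scheme.IdealSheafData.comapIso_hom_fst_assoc]

variable (f d b) in
/-- The locus where the functions `b` induce a basis of a family of closed subschemes. -/
noncomputable def hilbertLocus (T : Over S) (x : (hilbertFunctor f d).obj (op T)) : T.left.Opens :=
  locus (x.1.subschemeι ≫ pullback.snd f T.hom) (x.1.subschemeι ≫ pullback.fst f T.hom) b

lemma mem_hilbertLocus_map {T T' : Over S} (h : T' ⟶ T) (x : (hilbertFunctor f d).obj (op T))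
    (t : T'.left) : t ∈ hilbertLocus f d b T' ((hilbertFunctor f d).map h.op x) ↔
      h.left t ∈ hilbertLocus f d b T x := by
  obtain ⟨g', hp, hg'⟩ := isPullback_hilbertFunctor_map h x
  rw [hilbertLocus, ← hg']
  exact mem_locus_iff_of_isPullback hp x.2 t

lemma HasCoefficients.hilbertFunctor_map {T T' : Over S} {x : (hilbertFunctor f d).obj (op T)}
    {V : T.left.Opens} {c : Γ(X, U) → Fin d → Γ(T.left, V)}
    (hc : HasCoefficients (x.1.subschemeι ≫ pullback.snd f T.hom)
      (x.1.subschemeι ≫ pullback.fst f T.hom) b V c) (hV : IsAffineOpen V) (h : T' ⟶ T)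
    {V' : T'.left.Opens} (hV' : IsAffineOpen V') (hVV' : V' ≤ h.left ⁻¹ᵁ V) :
    HasCoefficients (((hilbertFunctor f d).map h.op x).1.subschemeι ≫ pullback.snd f T'.hom)
      (((hilbertFunctor f d).map h.op x).1.subschemeι ≫ pullback.fst f T'.hom) b V'
      fun y i ↦ (h.left.appLE V V' hVV').hom (c y i) := by
  obtain ⟨g', hp, hg'⟩ := isPullback_hilbertFunctor_map h x
  have := x.2.1
  rw [← hg']
  exact hc.of_isPullback hp hV hV' hVV'

lemma HasCoefficients.eq_of_isAffine [IsAffine S] {T : Over S} [IsAffine T.left]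
    (hU : IsAffineOpen U) {x y : (hilbertFunctor f d).obj (op T)}
    {c : Γ(X, U) → Fin d → Γ(T.left, ⊤)}
    (hx : HasCoefficients (x.1.subschemeι ≫ pullback.snd f T.hom)
      (x.1.subschemeι ≫ pullback.fst f T.hom) b ⊤ c)
    (hy : HasCoefficients (y.1.subschemeι ≫ pullback.snd f T.hom)
      (y.1.subschemeι ≫ pullback.fst f T.hom) b ⊤ c) : x = y := by
  have := ker_eq_of_hasCoefficients hU _ _ hx hy
  rw [Scheme.IdealSheafData.ker_subschemeι, Scheme.IdealSheafData.ker_subschemeι] at this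
  exact Subtype.ext this

lemma HasCoefficients.isCoefficients_top {T : Over S} {x : (hilbertFunctor f d).obj (op T)}
    {c : Γ(X, U) → Fin d → Γ(T.left, ⊤)}
    (hx : HasCoefficients (x.1.subschemeι ≫ pullback.snd f T.hom)
      (x.1.subschemeι ≫ pullback.fst f T.hom) b ⊤ c) :
    IsCoefficients (f.appLE ⊤ U le_top).hom T.hom.appTop.hom b c := by
  have h := hx.isCoefficients (f := f) (τ := T.hom) (W := ⊤)
    (by rw [Category.assoc, Category.assoc, pullback.condition]) le_top le_top
  exact (congrArg (fun k : Γ(S, ⊤) ⟶ Γ(T.left, ⊤) ↦ IsCoefficients _ k.hom b c)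
    (appLE_top_top T.hom le_top)).mp h

/-- Over affine bases, morphisms to `H` and families with basis `b` both amount to coefficient
tables. Pulling back `ξ` transports the universal table, so equal families give equal morphisms, and
a family with a table over an affine `V` is the pullback of `ξ` along the morphism given by that
table. The last clause, part of the proof that the chart is open, is exported because it also serves
to show that the charts cover. -/
lemma exists_isOpenChart [IsAffine S] [IsSeparated f] (hU : IsAffineOpen U)
    (b : Fin d → Γ(X, U)) :
    ∃ (H : Over S) (ξ : (hilbertFunctor f d).obj (op H)),
      IsOpenChart (hilbertFunctor f d) H ξ ∧
      ∀ (T : Over S) (x : (hilbertFunctor f d).obj (op T)), ∀ t ∈ hilbertLocus f d b T x,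
        ∃ V : T.left.Opens, t ∈ V ∧ ∃ a : Over.mk (V.ι ≫ T.hom) ⟶ H,
          (hilbertFunctor f d).map a.op ξ =
            (hilbertFunctor f d).map (Over.homMk V.ι : Over.mk (V.ι ≫ T.hom) ⟶ T).op x := by
  obtain ⟨H, ξ, c₀, _, hc₀, huniv⟩ := exists_universalFamily f hU b
  have hmap {T : Over S} (hT : IsAffine T.left) (a : T ⟶ H) :
      HasCoefficients (((hilbertFunctor f d).map a.op ξ).1.subschemeι ≫ pullback.snd f T.hom)
        (((hilbertFunctor f d).map a.op ξ).1.subschemeι ≫ pullback.fst f T.hom) b ⊤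
        fun y i ↦ a.left.appTop.hom (c₀ y i) := by
    have := hc₀.hilbertFunctor_map (isAffineOpen_top _) a (isAffineOpen_top _) (V' := ⊤) le_top
    refine (congrArg (HasCoefficients _ _ b _) ?_).mp this
    ext y i
    exact appLE_top_top_apply _ _ _
  have hex (T : Over S) (x : (hilbertFunctor f d).obj (op T)) (t) (ht : t ∈ hilbertLocus f d b T x) :
      ∃ V : T.left.Opens, t ∈ V ∧ ∃ a : Over.mk (V.ι ≫ T.hom) ⟶ H,
        (hilbertFunctor f d).map a.op ξ =
          (hilbertFunctor f d).map (Over.homMk V.ι : Over.mk (V.ι ≫ T.hom) ⟶ T).op x := by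
    obtain ⟨V, hV, htV, c, hc⟩ := ht
    have hT' : IsAffine (Over.mk (V.ι ≫ T.hom)).left := hV
    have h := hc.hilbertFunctor_map hV (Over.homMk V.ι : Over.mk (V.ι ≫ T.hom) ⟶ T)
      (isAffineOpen_top _) (V' := ⊤) (fun y _ ↦ y.2)
    obtain ⟨a, ha, -⟩ := huniv _ _ h.isCoefficients_top
    refine ⟨V, htV, a, HasCoefficients.eq_of_isAffine hU (hmap hT' a) ?_⟩
    refine (congrArg (HasCoefficients _ _ b _) ?_).mp h
    ext y i
    exact (ha y i).symm
  refine ⟨H, ξ, .of_isAffine (hasUniqueGluing_hilbertFunctor f d) (hilbertLocus f d b)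
    (fun _ _ ↦ mem_hilbertLocus_map) (fun t ↦ ⟨⊤, isAffineOpen_top _, trivial, c₀, hc₀⟩)
    (fun T hT a a' haa' ↦ ?_) hex, hex⟩
  have h' := hmap hT a'
  rw [← haa'] at h'
  have heq := (hmap hT a).unique h'
  exact (huniv T _ (hmap hT a).isCoefficients_top).unique (fun _ _ ↦ rfl)
    fun y i ↦ (congrFun (congrFun heq y) i).symm

lemma exists_mem_hilbertLocus [IsAffine S] (hX : IsAFScheme X) (T : Over S)
    (x : (hilbertFunctor f d).obj (op T)) (t : T.left) :
    ∃ i : Σ U : X.affineOpens, Fin d → Γ(X, U.1), t ∈ hilbertLocus f d i.2 T x := by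
  obtain ⟨I, hI⟩ := x
  obtain ⟨U, b, ht⟩ := exists_mem_locus hX I.subschemeι hI t
  exact ⟨⟨U, b⟩, ht⟩

end HilbertCharts

end HilbertPoints

theorem propositionP {X S : Scheme.{u}} [IsAffine S] (f : X ⟶ S)
    (hX : HilbertPoints.IsAFScheme X) (d : ℕ) :
    (HilbertPoints.hilbertFunctor f d).IsRepresentable := by
  have := hX.isSeparated f
  have hch (i : Σ U : X.affineOpens, Fin d → Γ(X, U.1)) :=
    HilbertPoints.exists_isOpenChart (f := f) i.1.2 i.2
  choose H ξ hξ hex using hch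
  refine HilbertPoints.isRepresentable_of_isOpenChart
    (HilbertPoints.hasUniqueGluing_hilbertFunctor f d) H ξ hξ fun T x t ↦ ?_
  obtain ⟨i, ht⟩ := HilbertPoints.exists_mem_hilbertLocus hX T x t
  obtain ⟨V, htV, a, ha⟩ := hex i T x t ht
  refine ⟨i, Over.mk (V.ι ≫ T.hom), Over.homMk V.ι, a, ?_, ?_, ?_⟩
  · exact inferInstanceAs (IsOpenImmersion V.ι)
  · exact ⟨⟨t, htV⟩, rfl⟩
  · exact ha
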